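/- For $u:\mathbb{Z}^d\to\mathbb{R}$ let $\Delta u(x)=\sum_{i=1}^d\big(u(x+e_i)+u(x-e_i)-2u(x)\big)$. For $p\in\mathbb{R}^d\setminus\{0\}$ set $H(p)=\Delta u(0)$, where $u:\mathbb{Z}^d\to\mathbb{R}$ is the solution of the half-space problem $$\Delta u(x)=0 \text{ if } p\cdot x>0,\qquad u(x)=0 \text{ if } p\cdot x\le 0,\qquad \sup_{p\cdot x>0}|u(x)-p\cdot x|<\infty .$$ Let $S(\theta)=\log\big(1+\tfrac1d\sum_{k=1}^d\cos\theta_k\big)$, a $2\pi\mathbb{Z}^d$-periodic function, with Fourier coefficients $\hat S(q)=\frac{1}{(2\pi)^d}\int_{[-\pi,\pi]^d}e^{-iq\cdot\theta}S(\theta)\,d\theta$, $q\in\mathbb{Z}^d$. Theorem. Let $d=2$. Then $S$ is integrable on $[-\pi,\pi]^2$, and for every $p\in\mathbb{R}^2\setminus\{0\}$ the half-space problem has exactly one solution (so that $\hat S(0)$ and $H$ are well defined). For every $p\in\mathbb{R}^2\setminus\{0\}$, $$\lim_{\substack{q\to p\\ q\notin\mathbb{R}p}}H(q)^2=4\exp(\hat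 S(0))\,|p|^2 ,$$ and if $p$ is not a real multiple of a nonzero integer vector, then the restriction $q\notin\mathbb{R}p$ can be dropped, that is, $\lim_{q\to p,\ q\ne p}H(q)^2=4\exp(\hat S(0))|p|^2$. Moreover, $H(p)^2<4\exp(\hat S(0))|p|^2$ if and only if $p$ is a real multiple of an element of $\mathbb{Z}^2\setminus\{0\}$. -/

import Mathlib

open Filter Topology MeasureTheory

noncomputable section

/-- The Euclidean scalar product `p · x` of a slope `p ∈ ℝ^d` and a lattice point `x ∈ ℤ^d`. -/
def slopeDot {d : ℕ} (p : EuclideanSpace ℝ (Fin d)) (x : Fin d → ℤ) : ℝ :=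
  ∑ i, p i * (x i : ℝ)

/-- The (unnormalized) discrete Laplacian on `ℤ^d`. -/
def latticeLaplacian {d : ℕ} (u : (Fin d → ℤ) → ℝ) (x : Fin d → ℤ) : ℝ :=
  ∑ i, (u (x + Pi.single i 1) + u (x - Pi.single i 1) - 2 * u x)

/-- `u` solves the half-space problem with slope `p`. -/
structure IsHalfSpaceSolution {d : ℕ} (p : EuclideanSpace ℝ (Fin d))
    (u : (Fin d → ℤ) → ℝ) : Prop where
  harmonic : ∀ x, 0 < slopeDot p x → latticeLaplacian u x = 0
  zero : ∀ x, slopeDot p x ≤ 0 → u x = 0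
  bounded : ∃ C : ℝ, ∀ x, 0 < slopeDot p x → |u x - slopeDot p x| ≤ C

/-- The Hamiltonian `H(p) = Δu(0)`, where `u` is the solution of the half-space problem with
slope `p`. -/
def latticeHamiltonian {d : ℕ} (p : EuclideanSpace ℝ (Fin d)) : ℝ :=
  latticeLaplacian (Classical.epsilon (IsHalfSpaceSolution p)) 0

/-- The symbol `S(θ) = log (1 + (1/d) ∑ cos θ_k)`. -/
def symbolS (d : ℕ) (θ : Fin d → ℝ) : ℝ :=
  Real.log (1 + (1 / (d : ℝ)) * ∑ k, Real.cos (θ k))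

/-- The period cell `[-π, π]^d`. -/
def periodCell (d : ℕ) : Set (Fin d → ℝ) :=
  Set.Icc (fun _ => -Real.pi) (fun _ => Real.pi)

/-- The Fourier coefficient of `S` at `q ∈ ℤ^d`: the average over the period cell of
`exp (-i q · θ) S(θ)`. It is real since `S` is even, so the real part is taken. -/
def symbolSHat (d : ℕ) (q : Fin d → ℤ) : ℝ :=
  (⨍ θ in periodCell d,
    Complex.exp (-Complex.I * ∑ k, (q k : ℂ) * (θ k : ℂ)) * (symbolS d θ : ℂ)).re

/-- `p` is a real multiple of a nonzero integer vector. -/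
def IsMultipleOfLatticeVector {d : ℕ} (p : EuclideanSpace ℝ (Fin d)) : Prop :=
  ∃ (t : ℝ) (z : Fin d → ℤ), z ≠ 0 ∧ ∀ i, p i = t * (z i : ℝ)

end

/-! Let S_n be the simple random walk on ℤ² and X_n = p·S_n, a symmetric walk on ℝ with bounded
steps. The Laplacian of a function of p·x is four times the generator of X, so the half-space
problem reduces to dimension one. Let V(t) be the renewal measure of [0,t) for the weak ascending
ladder heights of X, and m their mean. V vanishes for t ≤ 0, is harmonic for t > 0, has one-step
average 1 at t = 0, and mV(t) - t is bounded for t > 0 (`renewalFun_spec`). Hence mV(p·x) is a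
solution, unique by a maximum principle on strips, and H(p) = 4m.

The Wiener–Hopf factorization, carried out for power series over the group algebra of ℝ, yields m² =
(σ²/2) exp(-∑ P(X_n = 0)/n) with σ² = |p|²/2 (`ladder_moments`). This gives the explicit formula
H(p)² = 4|p|² exp(-∑ P(p·S_n = 0)/n) (`latticeHamiltonian_sq`).

Expanding the logarithm in S and integrating term by term gives Ŝ(0) = -∑ P(S_n = 0)/n
(`symbolSHat_zero`). It remains to compare the two series. Always P(S_n = 0) ≤ P(p·S_n = 0), with
strict inequality for some n exactly when a nonzero lattice vector is orthogonal to p; in the plane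
this means that p is a multiple of a lattice vector. For fixed n the walk reaches finitely many
points, so P(q·S_n = 0) is eventually equal to P(S_n = 0) as q → p away from ℝp, and the uniform
bound P(q·S_n = 0) ≤ n^(-1/2) lets the limit pass under the sum. -/

noncomputable section

/-! ### Formal exponentials of power series and their values inside the unit disc. -/

section ExpInt
open PowerSeries Finset
variable {R : Type*} [CommRing R] [Algebra ℝ R]

/-- The coefficients of the solution of `P' = Λ P`, `P(0) = 1`. -/
def expIntCoeff (Λ : PowerSeries R) : ℕ → R
  | 0 => 1
  | n + 1 => ((n + 1 : ℝ)⁻¹) • ∑ i : Fin (n + 1), coeff (n - i) Λ * expIntCoeff Λ i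

/-- The formal exponential of the primitive of `Λ`. -/
def expInt (Λ : PowerSeries R) : PowerSeries R := mk (expIntCoeff Λ)

lemma coeff_zero_expInt (Λ : PowerSeries R) : coeff 0 (expInt Λ) = 1 := by
  simp [expInt, expIntCoeff]

lemma coeff_succ_expInt (Λ : PowerSeries R) (n : ℕ) :
    coeff (n + 1) (expInt Λ) = ((n + 1 : ℝ)⁻¹) • coeff n (Λ * expInt Λ) := by
  rw [mul_comm, coeff_mul, Finset.Nat.sum_antidiagonal_eq_sum_range_succ_mk, expInt, coeff_mk,
    expIntCoeff, Finset.sum_range]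
  congr 1
  refine Finset.sum_congr rfl fun i _ => ?_
  simp [mul_comm]

/-- Uniqueness for P' = ΛP: the recursion fixes each coefficient by the earlier ones. All identities
between formal exponentials below are reduced to it. -/
lemma eq_expInt_of_coeff {Λ P : PowerSeries R} (h0 : coeff 0 P = 1)
    (h : ∀ n : ℕ, (n + 1 : ℝ) • coeff (n + 1) P = coeff n (Λ * P)) : P = expInt Λ := by
  ext n
  induction n using Nat.strong_induction_on with
  | _ n ih =>
    cases n with
    | zero => rw [h0, coeff_zero_expInt]
    | succ n =>
      have h1 : coeff n (Λ * P) = coeff n (Λ * expInt Λ) := by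
        rw [coeff_mul, coeff_mul]
        refine Finset.sum_congr rfl fun ij hij => ?_
        rw [ih ij.2 (by have := Finset.HasAntidiagonal.mem_antidiagonal.1 hij; omega)]
      rw [coeff_succ_expInt, ← h1, ← h n, smul_smul, inv_mul_cancel₀ (by positivity), one_smul]

lemma smul_coeff_succ (P : PowerSeries R) (n : ℕ) :
    (n + 1 : ℝ) • coeff (n + 1) P = coeff n (d⁄dX R P) := by
  rw [coeff_derivative, Algebra.smul_def, mul_comm]
  simp

lemma derivative_expInt (Λ : PowerSeries R) : d⁄dX R (expInt Λ) = Λ * expInt Λ := by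
  ext n
  rw [← smul_coeff_succ, coeff_succ_expInt, smul_smul, mul_inv_cancel₀ (by positivity), one_smul]

lemma eq_expInt {Λ P : PowerSeries R} (h0 : coeff 0 P = 1) (h : d⁄dX R P = Λ * P) :
    P = expInt Λ :=
  eq_expInt_of_coeff h0 fun n => by rw [smul_coeff_succ, h]

lemma expInt_add (Λ M : PowerSeries R) : expInt (Λ + M) = expInt Λ * expInt M := by
  symm
  apply eq_expInt
  · simp only [coeff_zero_eq_constantCoeff, map_mul]
    simp only [← coeff_zero_eq_constantCoeff_apply, coeff_zero_expInt, mul_one]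
  · rw [Derivation.leibniz, derivative_expInt, derivative_expInt, smul_eq_mul, smul_eq_mul]
    ring

lemma expInt_zero : expInt (0 : PowerSeries R) = 1 := by
  symm
  apply eq_expInt <;> simp

lemma expInt_mul_neg (Λ : PowerSeries R) : expInt Λ * expInt (-Λ) = 1 := by
  rw [← expInt_add, add_neg_cancel, expInt_zero]

/-- The series with coefficients a^(j+1) is the formal derivative of -log(1 - aX), so its
exponential is the geometric series. -/
lemma expInt_pow_succ (a : R) :
    expInt (mk fun j => a ^ (j + 1)) * (1 - C a * X) = 1 := by
  have h : (mk fun n => a ^ n) = expInt (mk fun j => a ^ (j + 1)) := by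
    apply eq_expInt_of_coeff
    · simp
    · intro n
      rw [coeff_mul, coeff_mk]
      have : ∀ ij ∈ antidiagonal n, coeff ij.1 (mk fun j => a ^ (j + 1)) *
          coeff ij.2 (mk fun j => a ^ j) = a ^ (n + 1) := by
        intro ij hij
        rw [coeff_mk, coeff_mk, ← pow_add, ← Finset.HasAntidiagonal.mem_antidiagonal.1 hij]
        congr 1; ring
      rw [Finset.sum_congr rfl this, Finset.sum_const, Finset.Nat.card_antidiagonal,
        ← Nat.cast_smul_eq_nsmul ℝ]
      push_cast; rfl
  rw [← h]
  ext n
  cases n with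
  | zero => simp
  | succ n =>
    rw [mul_sub, mul_one, ← mul_assoc, map_sub, coeff_succ_mul_X, mul_comm _ (C a), coeff_C_mul]
    simp [coeff_one, pow_succ']

lemma map_expInt {S : Type*} [CommRing S] [Algebra ℝ S] (f : R →ₐ[ℝ] S) (Λ : PowerSeries R) :
    map (f : R →+* S) (expInt Λ) = expInt (map (f : R →+* S) Λ) := by
  apply eq_expInt_of_coeff
  · rw [coeff_map, coeff_zero_expInt, map_one]
  · intro n
    rw [← map_mul, coeff_map, coeff_map, coeff_succ_expInt]
    simp only [RingHom.coe_coe, map_smul]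
    rw [smul_smul, mul_inv_cancel₀ (by positivity), one_smul]

/-- Induction principle for the coefficients of `expInt Λ`. -/
lemma coeff_expInt_induction {Λ : PowerSeries R} {S : R → Prop} (h0 : S 0) (h1 : S 1)
    (hadd : ∀ x y, S x → S y → S (x + y)) (hmul : ∀ x y, S x → S y → S (x * y))
    (hsmul : ∀ (c : ℝ) x, 0 ≤ c → S x → S (c • x)) (hΛ : ∀ n, S (coeff n Λ)) (n : ℕ) :
    S (coeff n (expInt Λ)) := by
  induction n using Nat.strong_induction_on with
  | _ n ih =>
    cases n with
    | zero => rwa [coeff_zero_expInt]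
    | succ n =>
      rw [coeff_succ_expInt, coeff_mul]
      refine hsmul _ _ (by positivity) (Finset.sum_induction _ S hadd h0 fun ij hij => ?_)
      exact hmul _ _ (hΛ _) (ih _ (by have := Finset.HasAntidiagonal.mem_antidiagonal.1 hij; omega))

/-- Induction principle for the coefficients of positive order of `expInt Λ`. -/
lemma coeff_succ_expInt_induction {Λ : PowerSeries R} {S : R → Prop} (h0 : S 0)
    (hadd : ∀ x y, S x → S y → S (x + y)) (hmul : ∀ x y, S x → S y → S (x * y))
    (hsmul : ∀ (c : ℝ) x, 0 ≤ c → S x → S (c • x)) (hΛ : ∀ n, S (coeff n Λ)) (n : ℕ) :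
    S (coeff (n + 1) (expInt Λ)) := by
  induction n using Nat.strong_induction_on with
  | _ n ih =>
    rw [coeff_succ_expInt, coeff_mul]
    refine hsmul _ _ (by positivity) (Finset.sum_induction _ S hadd h0 fun ij hij => ?_)
    have h := Finset.HasAntidiagonal.mem_antidiagonal.1 hij
    rcases ij with ⟨i, j⟩
    cases j with
    | zero => simpa [coeff_zero_expInt] using hΛ i
    | succ j => exact hmul _ _ (hΛ _) (ih _ (by simp at h; omega))

/-- The factor 1/(n+1) makes the coefficient of order n+1 an average of n+1 products, each of
modulus at most 1. -/
lemma abs_coeff_expInt_le {Λ : PowerSeries ℝ} (hΛ : ∀ n, |coeff n Λ| ≤ 1) (n : ℕ) :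
    |coeff n (expInt Λ)| ≤ 1 := by
  induction n using Nat.strong_induction_on with
  | _ n ih =>
    cases n with
    | zero => simp [coeff_zero_expInt]
    | succ n =>
      rw [coeff_succ_expInt, coeff_mul, smul_eq_mul, abs_mul, abs_of_nonneg (by positivity),
        inv_mul_le_iff₀ (by positivity), mul_one]
      refine (Finset.abs_sum_le_sum_abs _ _).trans ?_
      refine (Finset.sum_le_card_nsmul _ _ 1 fun ij hij => ?_).trans ?_
      · rw [abs_mul]
        exact mul_le_one₀ (hΛ _) (abs_nonneg _)
          (ih _ (by have := Finset.HasAntidiagonal.mem_antidiagonal.1 hij; omega))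
      · simp


/-- The value at `x` of a real power series. -/
def evalSeries (x : ℝ) (P : PowerSeries ℝ) : ℝ := ∑' n, coeff n P * x ^ n

lemma summable_norm_of_bounded {P : PowerSeries ℝ} {B x : ℝ} (hP : ∀ n, |coeff n P| ≤ B)
    (hx : |x| < 1) : Summable fun n => ‖coeff n P * x ^ n‖ := by
  refine Summable.of_nonneg_of_le (fun _ => norm_nonneg _) (fun n => ?_)
    ((summable_geometric_of_lt_one (abs_nonneg x) hx).mul_left B)
  rw [norm_mul, norm_pow, Real.norm_eq_abs, Real.norm_eq_abs]
  exact mul_le_mul_of_nonneg_right (hP n) (by positivity)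

lemma summable_of_bounded {P : PowerSeries ℝ} {B x : ℝ} (hP : ∀ n, |coeff n P| ≤ B)
    (hx : |x| < 1) : Summable fun n => coeff n P * x ^ n :=
  (summable_norm_of_bounded hP hx).of_norm

lemma coeff_mul_pow (P Q : PowerSeries ℝ) (x : ℝ) (n : ℕ) :
    coeff n (P * Q) * x ^ n =
      ∑ ij ∈ antidiagonal n, coeff ij.1 P * x ^ ij.1 * (coeff ij.2 Q * x ^ ij.2) := by
  rw [coeff_mul, Finset.sum_mul]
  refine Finset.sum_congr rfl fun ij hij => ?_
  rw [← Finset.HasAntidiagonal.mem_antidiagonal.1 hij, pow_add]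
  ring

lemma evalSeries_mul {P Q : PowerSeries ℝ} {x : ℝ} (hP : Summable fun n => ‖coeff n P * x ^ n‖)
    (hQ : Summable fun n => ‖coeff n Q * x ^ n‖) :
    evalSeries x (P * Q) = evalSeries x P * evalSeries x Q := by
  rw [evalSeries, evalSeries, evalSeries, tsum_mul_tsum_eq_tsum_sum_antidiagonal_of_summable_norm hP hQ]
  exact tsum_congr fun n => coeff_mul_pow P Q x n

lemma hasDerivAt_evalSeries {P : PowerSeries ℝ} {B x : ℝ} (hP : ∀ n, |coeff n P| ≤ B)
    (hx : |x| < 1) : HasDerivAt (fun y => evalSeries y P) (evalSeries x (d⁄dX ℝ P)) x := by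
  -- A radius strictly between |x| and 1 supplies a summable majorant for the differentiated series,
  -- uniform on a ball around 0 containing x.
  obtain ⟨ρ, hxρ, hρ⟩ := exists_between hx
  have hρ0 : 0 < ρ := (abs_nonneg x).trans_lt hxρ
  have hu : Summable fun n : ℕ => B * (n * ρ ^ (n - 1)) := by
    apply Summable.mul_left
    rw [← summable_nat_add_iff 1]
    have h1 := summable_pow_mul_geometric_of_norm_lt_one (R := ℝ) 1
      (r := ρ) (by rwa [Real.norm_eq_abs, abs_of_pos hρ0])
    have h2 := summable_geometric_of_lt_one hρ0.le hρ
    refine (h1.add h2).congr fun n => ?_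
    simp; ring
  have key := hasDerivAt_tsum_of_isPreconnected (g := fun n y => coeff n P * y ^ n)
    (g' := fun n y => coeff n P * (n * y ^ (n - 1))) (y₀ := x) hu Metric.isOpen_ball
    (convex_ball (0 : ℝ) ρ).isPreconnected
    (fun n y _ => (hasDerivAt_pow n y).const_mul _) (fun n y hy => ?_)
    (by simpa using hxρ) (summable_of_bounded hP hx) (by simpa using hxρ)
  · convert! key using 1
    rw [Summable.tsum_eq_zero_add]
    · simp only [evalSeries, coeff_derivative]
      simp
      exact tsum_congr fun n => by ring
    · refine Summable.of_norm_bounded hu fun n => ?_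
      rw [norm_mul, norm_mul, norm_pow, Real.norm_eq_abs, Real.norm_eq_abs, Real.norm_eq_abs,
        Nat.abs_cast]
      have := hP n
      gcongr
      exact (abs_nonneg _).trans this
  · rw [norm_mul, norm_mul, norm_pow, Real.norm_eq_abs, Real.norm_eq_abs, Real.norm_eq_abs,
      Nat.abs_cast]
    have h1 := hP n
    have h2 : |y| ≤ ρ := by simpa using (mem_ball_zero_iff.1 hy).le
    gcongr
    exact (abs_nonneg _).trans h1

/-- The primitive of a real power series. -/
def primitive (Λ : PowerSeries ℝ) : PowerSeries ℝ :=
  mk fun n => Nat.casesOn n 0 fun j => coeff j Λ / (j + 1)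

lemma coeff_zero_primitive (Λ : PowerSeries ℝ) : coeff 0 (primitive Λ) = 0 := by
  simp [primitive]

lemma coeff_succ_primitive (Λ : PowerSeries ℝ) (n : ℕ) :
    coeff (n + 1) (primitive Λ) = coeff n Λ / (n + 1) := by
  simp [primitive]

lemma derivative_primitive (Λ : PowerSeries ℝ) : d⁄dX ℝ (primitive Λ) = Λ := by
  ext n
  rw [coeff_derivative, coeff_succ_primitive, div_mul_cancel₀ _ (by positivity)]

lemma abs_coeff_primitive_le {Λ : PowerSeries ℝ} (hΛ : ∀ n, |coeff n Λ| ≤ 1) (n : ℕ) :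
    |coeff n (primitive Λ)| ≤ 1 := by
  cases n with
  | zero => simp [coeff_zero_primitive]
  | succ n =>
    rw [coeff_succ_primitive, abs_div, abs_of_pos (by positivity : (0 : ℝ) < n + 1)]
    exact div_le_one_of_le₀ ((hΛ n).trans (by linarith [n.cast_nonneg (α := ℝ)])) (by positivity)

lemma evalSeries_zero (P : PowerSeries ℝ) : evalSeries 0 P = coeff 0 P := by
  rw [evalSeries, tsum_eq_single 0]
  · simp
  · intro n hn; simp [hn]

theorem evalSeries_expInt {Λ : PowerSeries ℝ} (hΛ : ∀ n, |coeff n Λ| ≤ 1) {x : ℝ} (hx : |x| < 1) :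
    evalSeries x (expInt Λ) = Real.exp (evalSeries x (primitive Λ)) := by
  -- The quotient of the two sides has zero derivative on the unit ball and equals 1 at 0.
  set f : ℝ → ℝ := fun y => evalSeries y (expInt Λ) * Real.exp (-evalSeries y (primitive Λ)) with hf
  have hd : ∀ y ∈ Metric.ball (0 : ℝ) 1, HasDerivAt f 0 y := by
    intro y hy
    have hy' : |y| < 1 := by simpa using hy
    have h1 := hasDerivAt_evalSeries (abs_coeff_expInt_le hΛ) hy'
    have h2 := hasDerivAt_evalSeries (abs_coeff_primitive_le hΛ) hy'
    rw [derivative_expInt, evalSeries_mul (summable_norm_of_bounded hΛ hy')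
      (summable_norm_of_bounded (abs_coeff_expInt_le hΛ) hy')] at h1
    rw [derivative_primitive] at h2
    convert! h1.mul h2.neg.exp using 1
    simp only [Pi.neg_apply]
    ring
  have hc : f x = f 0 :=
    (Metric.isOpen_ball).is_const_of_deriv_eq_zero (convex_ball (0 : ℝ) 1).isPreconnected
      (fun y hy => (hd y hy).differentiableAt.differentiableWithinAt)
      (fun y hy => (hd y hy).deriv) (by simpa using hx) (by simp)
  simp only [hf, evalSeries_zero, coeff_zero_expInt, coeff_zero_primitive, Real.exp_zero,
    Real.exp_neg, inv_one, mul_one] at hc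
  rwa [← div_eq_mul_inv, div_eq_one_iff_eq (Real.exp_pos _).ne'] at hc

/-- For nonnegative coefficients, the limit of the values at `1` from the left is the sum. -/
theorem hasSum_of_tendsto_evalSeries {P : PowerSeries ℝ} {B l : ℝ} (hP : ∀ n, |coeff n P| ≤ B)
    (h0 : ∀ n, 0 ≤ coeff n P)
    (hl : Tendsto (fun r => evalSeries r P) (𝓝[<] 1) (𝓝 l)) : HasSum (fun n => coeff n P) l := by
  have hnear : ∀ᶠ r : ℝ in 𝓝[<] 1, 0 < r ∧ r < 1 := Ioo_mem_nhdsLT one_pos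
  -- Positivity gives a Tauberian argument: a finite partial sum at r is below the full value, hence
  -- at most `l` as r → 1. Abel's theorem then identifies the sum.
  have hsum : Summable fun n => coeff n P := by
    refine summable_of_sum_range_le (c := l) h0 fun N => ?_
    have hcont : Tendsto (fun r : ℝ => ∑ n ∈ range N, coeff n P * r ^ n) (𝓝[<] 1)
        (𝓝 (∑ n ∈ range N, coeff n P * 1 ^ n)) :=
      (Continuous.tendsto (by fun_prop) 1).mono_left nhdsWithin_le_nhds
    simp only [one_pow, mul_one] at hcont
    refine le_of_tendsto_of_tendsto hcont hl ?_
    filter_upwards [hnear] with r hr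
    exact (summable_of_bounded hP (by rw [abs_of_pos hr.1]; exact hr.2)).sum_le_tsum _
      (fun n _ => mul_nonneg (h0 n) (pow_nonneg hr.1.le n))
  have habel := Real.tendsto_tsum_powerSeries_nhdsWithin_lt hsum.hasSum.tendsto_sum_nat
  rw [tendsto_nhds_unique hl habel]
  exact hsum.hasSum

end ExpInt

/-! ### Finitely supported measures as elements of a group algebra. -/

section GroupAlgebra
open AddMonoidAlgebra

/-- The linear functional `∑ c_y δ_y ↦ ∑ c_y φ(y)` on a group algebra. -/
def pair {M : Type*} (φ : M → ℝ) : AddMonoidAlgebra ℝ M →ₗ[ℝ] ℝ where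
  toFun x := x.coeff.sum fun y c => c * φ y
  map_add' x y := by
    rw [coeff_add, Finsupp.sum_add_index'] <;> intros <;> ring
  map_smul' c x := by
    rw [coeff_smul, Finsupp.sum_smul_index' (by simp), Finsupp.smul_sum]
    simp [mul_assoc]

variable {M : Type*}

@[simp] lemma pair_single (φ : M → ℝ) (y : M) (c : ℝ) : pair φ (single y c) = c * φ y := by
  simp [pair]

lemma pair_apply (φ : M → ℝ) (x : AddMonoidAlgebra ℝ M) :
    pair φ x = x.coeff.sum fun y c => c * φ y := rfl

@[elab_as_elim]
lemma single_induction {P : AddMonoidAlgebra ℝ M → Prop} (x : AddMonoidAlgebra ℝ M)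
    (h0 : P 0) (hs : ∀ y c, P (single y c)) (hadd : ∀ x y, P x → P y → P (x + y)) : P x := by
  rcases x with ⟨f⟩
  induction f using Finsupp.induction_linear with
  | zero => exact h0
  | add f g hf hg => exact hadd _ _ hf hg
  | single a b => exact hs a b

/-- The product is convolution, so this is Fubini for a sum of two independent variables. It turns
formal identities into renewal equations. -/
lemma pair_mul [AddMonoid M] (φ : M → ℝ) (x y : AddMonoidAlgebra ℝ M) :
    pair φ (x * y) = pair (fun a => pair (fun b => φ (a + b)) y) x := by
  induction x using single_induction with
  | h0 => simp
  | hadd x x' hx hx' => rw [add_mul, map_add, map_add, hx, hx']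
  | hs a r =>
    induction y using single_induction with
    | h0 => simp
    | hadd y y' hy hy' =>
      rw [mul_add, map_add, hy, hy']
      simp [mul_add]
    | hs b s => simp [single_mul_single, mul_assoc]

lemma pair_congr {φ ψ : M → ℝ} {x : AddMonoidAlgebra ℝ M}
    (h : ∀ y, x.coeff y ≠ 0 → φ y = ψ y) : pair φ x = pair ψ x := by
  refine Finset.sum_congr rfl fun y hy => ?_
  simp only [h y (Finsupp.mem_support_iff.1 hy)]

lemma pair_eq_zero {φ : M → ℝ} {x : AddMonoidAlgebra ℝ M}
    (h : ∀ y, x.coeff y ≠ 0 → φ y = 0) : pair φ x = 0 := by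
  rw [pair_congr (ψ := fun _ => 0) h]
  simp [pair_apply]

lemma pair_add (φ ψ : M → ℝ) (x : AddMonoidAlgebra ℝ M) :
    pair (fun y => φ y + ψ y) x = pair φ x + pair ψ x := by
  simp [pair_apply, mul_add, Finsupp.sum_add]

lemma pair_const_mul (c : ℝ) (φ : M → ℝ) (x : AddMonoidAlgebra ℝ M) :
    pair (fun y => c * φ y) x = c * pair φ x := by
  simp [pair_apply, Finsupp.sum, Finset.mul_sum, mul_left_comm]

lemma pair_one [AddMonoid M] (φ : M → ℝ) : pair φ (1 : AddMonoidAlgebra ℝ M) = φ 0 := by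
  simp [one_def]

lemma coeff_eq_pair [DecidableEq M] (x : AddMonoidAlgebra ℝ M) (z : M) :
    x.coeff z = pair (fun y => if y = z then 1 else 0) x := by
  simp [pair_apply, Finsupp.sum]

/-- The coefficients of `x` are nonnegative and supported in `s`. -/
def NonnegOn (s : Set M) (x : AddMonoidAlgebra ℝ M) : Prop :=
  ∀ y, 0 ≤ x.coeff y ∧ (x.coeff y ≠ 0 → y ∈ s)

namespace NonnegOn
variable {s t : Set M} {x y : AddMonoidAlgebra ℝ M}

lemma mono (h : NonnegOn s x) (hst : s ⊆ t) : NonnegOn t x :=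
  fun y => ⟨(h y).1, fun hy => hst ((h y).2 hy)⟩

lemma zero : NonnegOn s 0 := fun y => by simp

lemma add (hx : NonnegOn s x) (hy : NonnegOn s y) : NonnegOn s (x + y) := by
  refine fun z => ⟨add_nonneg (hx z).1 (hy z).1, fun h => ?_⟩
  by_cases h1 : x.coeff z = 0
  · exact (hy z).2 fun h2 => h (by simp [h1, h2])
  · exact (hx z).2 h1

lemma smul {c : ℝ} (hc : 0 ≤ c) (hx : NonnegOn s x) : NonnegOn s (c • x) := by
  refine fun z => ⟨?_, fun h => (hx z).2 fun h2 => h (by simp [h2])⟩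
  simpa using mul_nonneg hc (hx z).1

lemma one [AddMonoid M] (h : 0 ∈ s) : NonnegOn s (1 : AddMonoidAlgebra ℝ M) := by
  classical
  intro z
  by_cases hz : z = 0
  · subst hz; simp [one_def, h]
  · simp [one_def, Ne.symm hz]

lemma pair_nonneg {φ : M → ℝ} (hx : NonnegOn s x) (hφ : ∀ y ∈ s, 0 ≤ φ y) : 0 ≤ pair φ x := by
  refine Finset.sum_nonneg fun y hy => ?_
  exact mul_nonneg (hx y).1 (hφ y ((hx y).2 (Finsupp.mem_support_iff.1 hy)))

lemma pair_mono {φ ψ : M → ℝ} (hx : NonnegOn s x) (h : ∀ y ∈ s, φ y ≤ ψ y) :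
    pair φ x ≤ pair ψ x := by
  refine Finset.sum_le_sum fun y hy => ?_
  exact mul_le_mul_of_nonneg_left (h y ((hx y).2 (Finsupp.mem_support_iff.1 hy))) (hx y).1

lemma mul [AddMonoid M] (hx : NonnegOn s x) (hy : NonnegOn t y) {w : Set M}
    (hw : ∀ a ∈ s, ∀ b ∈ t, a + b ∈ w) : NonnegOn w (x * y) := by
  classical
  intro z
  rw [coeff_eq_pair, pair_mul]
  refine ⟨hx.pair_nonneg fun a _ => hy.pair_nonneg fun b _ => by positivity, fun h => ?_⟩
  by_contra hz
  apply h
  refine pair_eq_zero fun a ha => pair_eq_zero fun b hb => ?_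
  rw [if_neg]
  rintro rfl
  exact hz (hw a ((hx a).2 ha) b ((hy b).2 hb))

end NonnegOn

open Classical in
/-- The restriction of an element of the group algebra to a set of exponents. -/
def restr (s : Set M) : AddMonoidAlgebra ℝ M →ₗ[ℝ] AddMonoidAlgebra ℝ M where
  toFun x := ofCoeff (x.coeff.filter (· ∈ s))
  map_add' x y := by ext; simp
  map_smul' c x := by ext; simp [Finsupp.filter_apply]

open Classical in
lemma coeff_restr (s : Set M) (x : AddMonoidAlgebra ℝ M) (y : M) :
    (restr s x).coeff y = if y ∈ s then x.coeff y else 0 := by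
  simp [restr, Finsupp.filter_apply]

lemma NonnegOn.restr {s : Set M} {x : AddMonoidAlgebra ℝ M} (hx : NonnegOn s x) (t : Set M) :
    NonnegOn (s ∩ t) (restr t x) := by
  classical
  intro y
  rw [coeff_restr]
  split_ifs with h
  · exact ⟨(hx y).1, fun h' => ⟨(hx y).2 h', h⟩⟩
  · simp

lemma restr_add_restr_compl (s : Set M) (x : AddMonoidAlgebra ℝ M) :
    restr s x + restr sᶜ x = x := by
  classical
  ext y
  simp only [coeff_add, Finsupp.add_apply, coeff_restr, Set.mem_compl_iff]
  by_cases h : y ∈ s <;> simp [h]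

/-- The total mass, as an algebra homomorphism. -/
def mass (M : Type*) [AddCommMonoid M] : AddMonoidAlgebra ℝ M →ₐ[ℝ] ℝ :=
  AlgHom.ofLinearMap (pair fun _ => 1) (by rw [pair_one]) fun x y => by
    rw [pair_mul, mul_comm, ← pair_const_mul]
    simp

lemma mass_apply [AddCommMonoid M] (x : AddMonoidAlgebra ℝ M) : mass M x = pair (fun _ => 1) x := rfl

end GroupAlgebra

/-! ### The Wiener–Hopf factorization of 1 - aX. -/

section WienerHopf
open AddMonoidAlgebra PowerSeries Finset

/-- All exponents of `x` lie in `s`. -/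
def SuppOn {M : Type*} (s : Set M) (x : AddMonoidAlgebra ℝ M) : Prop :=
  ∀ y, x.coeff y ≠ 0 → y ∈ s

namespace SuppOn
variable {M : Type*} {s t : Set M} {x y : AddMonoidAlgebra ℝ M}

lemma zero : SuppOn s (0 : AddMonoidAlgebra ℝ M) := fun y => by simp

lemma add (hx : SuppOn s x) (hy : SuppOn s y) : SuppOn s (x + y) := by
  intro z h
  by_cases h1 : x.coeff z = 0
  · exact hy z fun h2 => h (by simp [h1, h2])
  · exact hx z h1

lemma smul (c : ℝ) (hx : SuppOn s x) : SuppOn s (c • x) :=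
  fun z h => hx z fun h2 => h (by simp [h2])

lemma mul [AddMonoid M] (hx : SuppOn s x) (hy : SuppOn t y) {w : Set M}
    (hw : ∀ a ∈ s, ∀ b ∈ t, a + b ∈ w) : SuppOn w (x * y) := by
  classical
  intro z h
  by_contra hz
  apply h
  rw [coeff_eq_pair, pair_mul]
  refine pair_eq_zero fun a ha => pair_eq_zero fun b hb => ?_
  rw [if_neg]
  rintro rfl
  exact hz (hw a (hx a ha) b (hy b hb))

lemma neg_restr (s : Set M) (x : AddMonoidAlgebra ℝ M) : SuppOn s (-restr s x) := by
  classical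
  intro y hy
  by_contra h
  exact hy (by simp [coeff_restr, h])

end SuppOn

/-- The part of the powers `a ^ (j + 1)` with exponents in `s`. -/
def restrSeries (s : Set ℝ) (a : AddMonoidAlgebra ℝ ℝ) : PowerSeries (AddMonoidAlgebra ℝ ℝ) :=
  PowerSeries.mk fun j => restr s (a ^ (j + 1))

/-- The generating function of the weak ascending renewal measures. -/
def weakRenewal (a : AddMonoidAlgebra ℝ ℝ) : PowerSeries (AddMonoidAlgebra ℝ ℝ) :=
  expInt (restrSeries (Set.Ici 0) a)

/-- The generating function of the strict descending renewal measures. -/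
def strictRenewal (a : AddMonoidAlgebra ℝ ℝ) : PowerSeries (AddMonoidAlgebra ℝ ℝ) :=
  expInt (restrSeries (Set.Iio 0) a)

/-- The generating function of the weak ascending ladder height. -/
def weakLadder (a : AddMonoidAlgebra ℝ ℝ) : PowerSeries (AddMonoidAlgebra ℝ ℝ) :=
  1 - expInt (-restrSeries (Set.Ici 0) a)

/-- The generating function of the strict descending ladder height. -/
def strictLadder (a : AddMonoidAlgebra ℝ ℝ) : PowerSeries (AddMonoidAlgebra ℝ ℝ) :=
  1 - expInt (-restrSeries (Set.Iio 0) a)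

/-- The return probabilities of the walk. -/
def returnSeries (a : AddMonoidAlgebra ℝ ℝ) : PowerSeries ℝ :=
  PowerSeries.mk fun j => (a ^ (j + 1)).coeff 0

variable (a : AddMonoidAlgebra ℝ ℝ)

lemma restrSeries_add : restrSeries (Set.Ici 0) a + restrSeries (Set.Iio 0) a =
    PowerSeries.mk fun j => a ^ (j + 1) := by
  ext1 n
  simp only [restrSeries, map_add, PowerSeries.coeff_mk]
  rw [← Set.compl_Ici]
  exact restr_add_restr_compl _ _

lemma weakRenewal_mul_strictRenewal :
    weakRenewal a * strictRenewal a * (1 - C a * X) = 1 := by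
  rw [weakRenewal, strictRenewal, ← expInt_add, restrSeries_add, expInt_pow_succ]

lemma one_sub_weakLadder_mul : (1 - weakLadder a) * weakRenewal a = 1 := by
  rw [weakLadder, weakRenewal, sub_sub_cancel, mul_comm, expInt_mul_neg]

lemma one_sub_strictLadder_mul : (1 - strictLadder a) * strictRenewal a = 1 := by
  rw [strictLadder, strictRenewal, sub_sub_cancel, mul_comm, expInt_mul_neg]

lemma one_sub_mul_weakRenewal : (1 - C a * X) * weakRenewal a = 1 - strictLadder a := by
  linear_combination (1 - strictLadder a) * weakRenewal_mul_strictRenewal a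
    - (1 - C a * X) * weakRenewal a * one_sub_strictLadder_mul a

lemma one_sub_mul_strictRenewal : (1 - C a * X) * strictRenewal a = 1 - weakLadder a := by
  linear_combination (1 - weakLadder a) * weakRenewal_mul_strictRenewal a
    - (1 - C a * X) * strictRenewal a * one_sub_weakLadder_mul a

/-- The Wiener–Hopf factorization. -/
lemma one_sub_ladder_mul : (1 - weakLadder a) * (1 - strictLadder a) = 1 - C a * X := by
  linear_combination (1 - C a * X) * one_sub_weakLadder_mul a
    - (1 - weakLadder a) * one_sub_mul_weakRenewal a

lemma coeff_succ_one_sub_mul (P : PowerSeries (AddMonoidAlgebra ℝ ℝ)) (n : ℕ) :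
    PowerSeries.coeff (n + 1) ((1 - C a * X) * P)
      = PowerSeries.coeff (n + 1) P - a * PowerSeries.coeff n P := by
  rw [sub_mul, one_mul, map_sub, mul_assoc, PowerSeries.coeff_C_mul, PowerSeries.coeff_succ_X_mul]

lemma coeff_succ_strictLadder (n : ℕ) : PowerSeries.coeff (n + 1) (strictLadder a) =
    a * PowerSeries.coeff n (weakRenewal a) - PowerSeries.coeff (n + 1) (weakRenewal a) := by
  have h := congrArg (PowerSeries.coeff (n + 1)) (one_sub_mul_weakRenewal a)
  rw [coeff_succ_one_sub_mul, map_sub, PowerSeries.coeff_one, if_neg (by omega)] at h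
  linear_combination h

lemma coeff_succ_weakLadder (n : ℕ) : PowerSeries.coeff (n + 1) (weakLadder a) =
    a * PowerSeries.coeff n (strictRenewal a) - PowerSeries.coeff (n + 1) (strictRenewal a) := by
  have h := congrArg (PowerSeries.coeff (n + 1)) (one_sub_mul_strictRenewal a)
  rw [coeff_succ_one_sub_mul, map_sub, PowerSeries.coeff_one, if_neg (by omega)] at h
  linear_combination h

lemma coeff_zero_weakLadder : PowerSeries.coeff 0 (weakLadder a) = 0 := by
  rw [weakLadder, map_sub, coeff_zero_expInt]; simp

lemma coeff_zero_strictLadder : PowerSeries.coeff 0 (strictLadder a) = 0 := by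
  rw [strictLadder, map_sub, coeff_zero_expInt]; simp

variable {a} {C₀ : ℝ}

lemma NonnegOn.pow {s : Set ℝ} (ha : NonnegOn s a) (n : ℕ) : NonnegOn Set.univ (a ^ n) := by
  induction n with
  | zero => exact NonnegOn.one trivial
  | succ n ih => rw [pow_succ]; exact ih.mul ha fun _ _ _ _ => trivial

lemma nonnegOn_weakRenewal {s : Set ℝ} (ha : NonnegOn s a) (n : ℕ) :
    NonnegOn (Set.Ici 0) (PowerSeries.coeff n (weakRenewal a)) := by
  refine coeff_expInt_induction (S := NonnegOn (Set.Ici 0)) .zero (.one (Set.mem_Ici.2 le_rfl))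
    (fun x y => .add) (fun x y hx hy => hx.mul hy fun p hp q hq => ?_)
    (fun c x hc hx => hx.smul hc) (fun n => ?_) n
  · exact add_nonneg (Set.mem_Ici.1 hp) (Set.mem_Ici.1 hq)
  · simp only [restrSeries, PowerSeries.coeff_mk]
    exact ((ha.pow _).restr _).mono Set.inter_subset_right

lemma nonnegOn_strictRenewal {s : Set ℝ} (ha : NonnegOn s a) (n : ℕ) :
    NonnegOn (Set.Iio 0) (PowerSeries.coeff (n + 1) (strictRenewal a)) := by
  refine coeff_succ_expInt_induction (S := NonnegOn (Set.Iio 0)) .zero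
    (fun x y => .add) (fun x y hx hy => hx.mul hy fun p hp q hq => ?_)
    (fun c x hc hx => hx.smul hc) (fun n => ?_) n
  · exact add_neg (Set.mem_Iio.1 hp) (Set.mem_Iio.1 hq)
  · simp only [restrSeries, PowerSeries.coeff_mk]
    exact ((ha.pow _).restr _).mono Set.inter_subset_right

lemma nonnegOn_strictRenewal_Iic {s : Set ℝ} (ha : NonnegOn s a) (n : ℕ) :
    NonnegOn (Set.Iic 0) (PowerSeries.coeff n (strictRenewal a)) := by
  cases n with
  | zero => rw [strictRenewal, coeff_zero_expInt]; exact .one (Set.mem_Iic.2 le_rfl)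
  | succ n => exact (nonnegOn_strictRenewal ha n).mono Set.Iio_subset_Iic_self

lemma suppOn_expInt_neg {s : Set ℝ} (hs : ∀ x ∈ s, ∀ y ∈ s, x + y ∈ s) (n : ℕ) :
    SuppOn s (PowerSeries.coeff (n + 1) (expInt (-restrSeries s a))) := by
  refine coeff_succ_expInt_induction (S := SuppOn s) .zero (fun x y => .add)
    (fun x y hx hy => hx.mul hy hs) (fun c x _ hx => hx.smul c) (fun n => ?_) n
  simp only [restrSeries, map_neg, PowerSeries.coeff_mk]
  exact SuppOn.neg_restr s _

/-- Positivity is hidden in the definition by an alternating exponential. That exponential excludes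
exponents y ≥ 0; for y < 0 the weak renewal term in `coeff_succ_strictLadder` vanishes and only the
nonnegative product of `a` with a renewal measure is left. One step down from [0,∞) cannot go below
-C₀. -/
lemma nonnegOn_strictLadder (ha : NonnegOn (Set.Icc (-C₀) C₀) a) (n : ℕ) :
    NonnegOn (Set.Ico (-C₀) 0) (PowerSeries.coeff n (strictLadder a)) := by
  cases n with
  | zero => rw [coeff_zero_strictLadder]; exact .zero
  | succ n =>
    intro y
    have hG := nonnegOn_weakRenewal ha
    have haG : NonnegOn (Set.Ici (-C₀)) (a * PowerSeries.coeff n (weakRenewal a)) :=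
      ha.mul (hG n) fun p hp q hq => by
        have := hp.1; have := Set.mem_Ici.1 hq; simp only [Set.mem_Ici]; linarith
    by_cases hy : y < 0
    · have h0 : (PowerSeries.coeff (n + 1) (weakRenewal a)).coeff y = 0 := by
        by_contra h
        exact absurd ((hG (n + 1) y).2 h) (not_le.2 hy)
      have h1 : (PowerSeries.coeff (n + 1) (strictLadder a)).coeff y =
          (a * PowerSeries.coeff n (weakRenewal a)).coeff y := by
        rw [coeff_succ_strictLadder, AddMonoidAlgebra.coeff_sub, Finsupp.sub_apply, h0, sub_zero]
      rw [h1]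
      exact ⟨(haG y).1, fun h => ⟨(haG y).2 h, hy⟩⟩
    · have h0 : (PowerSeries.coeff (n + 1) (strictLadder a)).coeff y = 0 := by
        rw [strictLadder, map_sub, PowerSeries.coeff_one, if_neg (by omega), zero_sub]
        by_contra h
        refine hy (suppOn_expInt_neg (a := a) (s := Set.Iio 0) (fun x hx y hy => ?_) n y fun h' => h ?_)
        · exact add_neg (Set.mem_Iio.1 hx) (Set.mem_Iio.1 hy)
        · simp [h']
      simp [h0]

lemma nonnegOn_weakLadder (ha : NonnegOn (Set.Icc (-C₀) C₀) a) (n : ℕ) :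
    NonnegOn (Set.Icc 0 C₀) (PowerSeries.coeff n (weakLadder a)) := by
  cases n with
  | zero => rw [coeff_zero_weakLadder]; exact .zero
  | succ n =>
    intro y
    have haG : NonnegOn (Set.Iic C₀) (a * PowerSeries.coeff n (strictRenewal a)) :=
      ha.mul (nonnegOn_strictRenewal_Iic ha n) fun p hp q hq => by
        have := hp.2; have := Set.mem_Iic.1 hq; simp only [Set.mem_Iic]; linarith
    by_cases hy : 0 ≤ y
    · have h0 : (PowerSeries.coeff (n + 1) (strictRenewal a)).coeff y = 0 := by
        by_contra h
        exact absurd ((nonnegOn_strictRenewal ha n y).2 h) (not_lt.2 hy)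
      have h1 : (PowerSeries.coeff (n + 1) (weakLadder a)).coeff y =
          (a * PowerSeries.coeff n (strictRenewal a)).coeff y := by
        rw [coeff_succ_weakLadder, AddMonoidAlgebra.coeff_sub, Finsupp.sub_apply, h0, sub_zero]
      rw [h1]
      exact ⟨(haG y).1, fun h => ⟨hy, (haG y).2 h⟩⟩
    · have h0 : (PowerSeries.coeff (n + 1) (weakLadder a)).coeff y = 0 := by
        rw [weakLadder, map_sub, PowerSeries.coeff_one, if_neg (by omega), zero_sub]
        by_contra h
        refine hy (suppOn_expInt_neg (a := a) (s := Set.Ici 0) (fun x hx y hy => ?_) n y fun h' => h ?_)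
        · exact add_nonneg (Set.mem_Ici.1 hx) (Set.mem_Ici.1 hy)
        · simp [h']
      simp [h0]

/-- The reflection of exponents. -/
def reflect : AddMonoidAlgebra ℝ ℝ →ₐ[ℝ] AddMonoidAlgebra ℝ ℝ :=
  AddMonoidAlgebra.mapDomainAlgHom ℝ ℝ (negAddMonoidHom : ℝ →+ ℝ)

@[simp] lemma reflect_single (y c : ℝ) : reflect (single y c) = single (-y) c := by
  simp [reflect]

lemma coeff_reflect (x : AddMonoidAlgebra ℝ ℝ) (y : ℝ) : (reflect x).coeff y = x.coeff (-y) := by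
  classical
  induction x using single_induction with
  | h0 => simp
  | hadd x x' hx hx' => simp [hx, hx']
  | hs z c => simp [Finsupp.single_apply, neg_eq_iff_eq_neg]

lemma pair_reflect (φ : ℝ → ℝ) (x : AddMonoidAlgebra ℝ ℝ) :
    pair φ (reflect x) = pair (fun y => φ (-y)) x := by
  induction x using single_induction with
  | h0 => simp
  | hadd x x' hx hx' => simp [hx, hx']
  | hs z c => simp

/-- Symmetry of the walk makes the positive part of each power the mirror image of the negative
part; the atom at 0 is left over and gives the return probabilities. -/
lemma restrSeries_Ici (hsymm : reflect a = a) : restrSeries (Set.Ici 0) a =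
    PowerSeries.map (algebraMap ℝ (AddMonoidAlgebra ℝ ℝ)) (returnSeries a) +
      PowerSeries.map (reflect : AddMonoidAlgebra ℝ ℝ →+* AddMonoidAlgebra ℝ ℝ)
        (restrSeries (Set.Iio 0) a) := by
  classical
  ext n y
  have hs : ∀ y, (a ^ (n + 1)).coeff (-y) = (a ^ (n + 1)).coeff y := fun y => by
    rw [← coeff_reflect, map_pow, hsymm]
  simp only [restrSeries, returnSeries, map_add, PowerSeries.coeff_map, PowerSeries.coeff_mk,
    RingHom.coe_coe, AddMonoidAlgebra.coeff_add, Finsupp.add_apply, coeff_reflect, coeff_restr,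
    Set.mem_Ici, Set.mem_Iio, hs, AddMonoidAlgebra.coe_algebraMap, Function.comp_apply,
    coeff_single, Finsupp.single_apply, Algebra.algebraMap_self, RingHom.id_apply]
  rcases lt_trichotomy y 0 with h | h | h
  · simp [h.ne', not_le.2 h, h.le]
  · simp [h]
  · simp [h.ne, h, h.le]

/-- Consequently the two Wiener–Hopf factors are mirror images up to a scalar series, the
exponential that appears in the final formula. -/
lemma one_sub_weakLadder (hsymm : reflect a = a) : 1 - weakLadder a =
    PowerSeries.map (algebraMap ℝ (AddMonoidAlgebra ℝ ℝ)) (expInt (-returnSeries a)) *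
      PowerSeries.map (reflect : AddMonoidAlgebra ℝ ℝ →+* AddMonoidAlgebra ℝ ℝ)
        (1 - strictLadder a) := by
  have h := map_expInt (Algebra.ofId ℝ (AddMonoidAlgebra ℝ ℝ)) (-returnSeries a)
  rw [weakLadder, strictLadder, sub_sub_cancel, sub_sub_cancel, map_expInt, restrSeries_Ici hsymm,
    neg_add, expInt_add, map_neg]
  congr 1
  rw [← map_neg]
  exact h.symm

end WienerHopf

/-! ### Mass and mean of the ladder heights. -/

section LadderMoments
open AddMonoidAlgebra PowerSeries Finset

/-- Coefficientwise application of `pair φ`. -/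
def pairSeries (φ : ℝ → ℝ) : PowerSeries (AddMonoidAlgebra ℝ ℝ) →ₗ[ℝ] PowerSeries ℝ where
  toFun P := PowerSeries.mk fun n => pair φ (PowerSeries.coeff n P)
  map_add' P Q := by ext n; simp
  map_smul' c P := by
    ext n
    simp only [PowerSeries.coeff_mk, RingHom.id_apply, PowerSeries.coeff_smul]
    rw [map_smul]

lemma coeff_pairSeries (φ : ℝ → ℝ) (P : PowerSeries (AddMonoidAlgebra ℝ ℝ)) (n : ℕ) :
    PowerSeries.coeff n (pairSeries φ P) = pair φ (PowerSeries.coeff n P) := by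
  simp [pairSeries]

lemma pairSeries_one (φ : ℝ → ℝ) : pairSeries φ 1 = φ 0 • 1 := by
  ext n
  rw [coeff_pairSeries, PowerSeries.coeff_smul, PowerSeries.coeff_one, PowerSeries.coeff_one]
  split_ifs
  · simp [pair_one]
  · simp

lemma pairSeries_const_eq_map (P : PowerSeries (AddMonoidAlgebra ℝ ℝ)) :
    pairSeries (fun _ => 1) P =
      PowerSeries.map (mass ℝ : AddMonoidAlgebra ℝ ℝ →+* ℝ) P := by
  ext n
  rw [coeff_pairSeries, PowerSeries.coeff_map]
  rfl

lemma pairSeries_const_mul (P Q : PowerSeries (AddMonoidAlgebra ℝ ℝ)) :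
    pairSeries (fun _ => 1) (P * Q) = pairSeries (fun _ => 1) P * pairSeries (fun _ => 1) Q := by
  simp only [pairSeries_const_eq_map, map_mul]

lemma pairSeries_map_reflect (φ : ℝ → ℝ) (P : PowerSeries (AddMonoidAlgebra ℝ ℝ)) :
    pairSeries φ (PowerSeries.map (reflect : AddMonoidAlgebra ℝ ℝ →+* AddMonoidAlgebra ℝ ℝ) P) =
      pairSeries (fun y => φ (-y)) P := by
  ext n
  rw [coeff_pairSeries, coeff_pairSeries, PowerSeries.coeff_map, ← pair_reflect]
  rfl

lemma pairSeries_algebraMap_mul (φ : ℝ → ℝ) (Q : PowerSeries ℝ)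
    (P : PowerSeries (AddMonoidAlgebra ℝ ℝ)) :
    pairSeries φ (PowerSeries.map (algebraMap ℝ (AddMonoidAlgebra ℝ ℝ)) Q * P) =
      Q * pairSeries φ P := by
  ext n
  rw [coeff_pairSeries, PowerSeries.coeff_mul, PowerSeries.coeff_mul, map_sum]
  refine Finset.sum_congr rfl fun ij _ => ?_
  rw [PowerSeries.coeff_map, ← Algebra.smul_def, map_smul, coeff_pairSeries, smul_eq_mul]

lemma pair_sq_mul (x y : AddMonoidAlgebra ℝ ℝ) : pair (fun t => t ^ 2) (x * y) =
    pair (fun t => t ^ 2) x * pair (fun _ => 1) y + 2 * (pair (fun t => t) x * pair (fun t => t) y)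
      + pair (fun _ => 1) x * pair (fun t => t ^ 2) y := by
  induction x using single_induction with
  | h0 => simp
  | hadd x x' hx hx' =>
    rw [add_mul, map_add, map_add, map_add, map_add]
    linear_combination hx + hx'
  | hs s c =>
    induction y using single_induction with
    | h0 => simp
    | hadd y y' hy hy' =>
      rw [mul_add, map_add, map_add, map_add, map_add]
      linear_combination hy + hy'
    | hs t d => rw [single_mul_single]; simp only [pair_single]; ring

lemma pairSeries_sq_mul (P Q : PowerSeries (AddMonoidAlgebra ℝ ℝ)) :
    pairSeries (fun t => t ^ 2) (P * Q) =
    pairSeries (fun t => t ^ 2) P * pairSeries (fun _ => 1) Q +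
      2 • (pairSeries (fun t => t) P * pairSeries (fun t => t) Q)
      + pairSeries (fun _ => 1) P * pairSeries (fun t => t ^ 2) Q := by
  ext n
  rw [map_add, map_add, map_nsmul, coeff_pairSeries]
  simp only [PowerSeries.coeff_mul, map_sum]
  rw [Finset.smul_sum, ← Finset.sum_add_distrib, ← Finset.sum_add_distrib]
  refine Finset.sum_congr rfl fun ij _ => ?_
  simp only [coeff_pairSeries, pair_sq_mul, nsmul_eq_mul, Nat.cast_ofNat]

lemma pairSeries_one_sub_C_mul_X (φ : ℝ → ℝ) (a : AddMonoidAlgebra ℝ ℝ) :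
    pairSeries φ (1 - C a * X) = φ 0 • 1 - C (pair φ a) * X := by
  ext n
  rw [map_sub, pairSeries_one, map_sub, map_sub, coeff_pairSeries]
  congr 1
  cases n with
  | zero => simp
  | succ n =>
    rw [PowerSeries.coeff_C_mul, PowerSeries.coeff_C_mul, PowerSeries.coeff_X, PowerSeries.coeff_X]
    split_ifs <;> simp

lemma evalSeries_sub {P Q : PowerSeries ℝ} {x : ℝ} (hP : Summable fun n => ‖PowerSeries.coeff n P * x ^ n‖)
    (hQ : Summable fun n => ‖PowerSeries.coeff n Q * x ^ n‖) :
    evalSeries x (P - Q) = evalSeries x P - evalSeries x Q := by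
  rw [evalSeries, evalSeries, evalSeries, ← hP.of_norm.tsum_sub hQ.of_norm]
  exact tsum_congr fun n => by rw [map_sub]; ring

lemma evalSeries_add {P Q : PowerSeries ℝ} {x : ℝ} (hP : Summable fun n => ‖PowerSeries.coeff n P * x ^ n‖)
    (hQ : Summable fun n => ‖PowerSeries.coeff n Q * x ^ n‖) :
    evalSeries x (P + Q) = evalSeries x P + evalSeries x Q := by
  rw [evalSeries, evalSeries, evalSeries, ← hP.of_norm.tsum_add hQ.of_norm]
  exact tsum_congr fun n => by rw [map_add]; ring

lemma summable_norm_mul {P Q : PowerSeries ℝ} {x : ℝ}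
    (hP : Summable fun n => ‖PowerSeries.coeff n P * x ^ n‖)
    (hQ : Summable fun n => ‖PowerSeries.coeff n Q * x ^ n‖) :
    Summable fun n => ‖PowerSeries.coeff n (P * Q) * x ^ n‖ := by
  refine (summable_norm_sum_mul_antidiagonal_of_summable_norm hP hQ).congr fun n => ?_
  rw [coeff_mul_pow]

lemma summable_norm_add {P Q : PowerSeries ℝ} {x : ℝ}
    (hP : Summable fun n => ‖PowerSeries.coeff n P * x ^ n‖)
    (hQ : Summable fun n => ‖PowerSeries.coeff n Q * x ^ n‖) :
    Summable fun n => ‖PowerSeries.coeff n (P + Q) * x ^ n‖ := by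
  refine Summable.of_nonneg_of_le (fun _ => norm_nonneg _) (fun n => ?_) (hP.add hQ)
  rw [map_add, add_mul]
  exact norm_add_le _ _

lemma evalSeries_one_sub {P : PowerSeries ℝ} {x : ℝ}
    (hP : Summable fun n => ‖PowerSeries.coeff n P * x ^ n‖) :
    evalSeries x (1 - P) = 1 - evalSeries x P := by
  have h1 : ∀ n ∉ ({0} : Finset ℕ), ‖PowerSeries.coeff n (1 : PowerSeries ℝ) * x ^ n‖ = 0 := by
    intro n hn
    rw [PowerSeries.coeff_one, if_neg (by simpa using hn)]; simp
  rw [evalSeries_sub (summable_of_ne_finset_zero h1) hP]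
  congr 1
  rw [evalSeries, tsum_eq_single 0]
  · simp
  · intro n hn; simp [PowerSeries.coeff_one, hn]

lemma evalSeries_C_mul_X (c x : ℝ) : evalSeries x (C c * X) = c * x := by
  rw [evalSeries, tsum_eq_single 1]
  · simp
  · intro n hn; simp [PowerSeries.coeff_C_mul, PowerSeries.coeff_X, hn]

lemma summable_norm_C_mul_X (c x : ℝ) :
    Summable fun n => ‖PowerSeries.coeff n (C c * X : PowerSeries ℝ) * x ^ n‖ := by
  refine summable_of_ne_finset_zero (s := {1}) fun n hn => ?_
  simp [PowerSeries.coeff_C_mul, PowerSeries.coeff_X, by simpa using hn]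

variable {a : AddMonoidAlgebra ℝ ℝ} {s : Set ℝ}

lemma mass_restr_mem (ha : NonnegOn s a) (hmass : mass ℝ a = 1) (t : Set ℝ) (n : ℕ) :
    0 ≤ mass ℝ (restr t (a ^ n)) ∧ mass ℝ (restr t (a ^ n)) ≤ 1 := by
  have h : ∀ t, 0 ≤ mass ℝ (restr t (a ^ n)) := fun t =>
    ((ha.pow n).restr t).pair_nonneg fun _ _ => zero_le_one
  refine ⟨h t, ?_⟩
  have h1 := congrArg (mass ℝ) (restr_add_restr_compl t (a ^ n))
  rw [map_add, map_pow (mass ℝ), hmass, one_pow] at h1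
  linarith [h tᶜ]

lemma NonnegOn.coeff_le_mass {M : Type*} [AddCommMonoid M] {s : Set M} {x : AddMonoidAlgebra ℝ M}
    (hx : NonnegOn s x) (y : M) : x.coeff y ≤ mass M x := by
  classical
  rw [coeff_eq_pair]
  exact hx.pair_mono fun z _ => by split_ifs <;> norm_num

lemma coeff_returnSeries_mem (ha : NonnegOn s a) (hmass : mass ℝ a = 1) (n : ℕ) :
    0 ≤ PowerSeries.coeff n (returnSeries a) ∧ PowerSeries.coeff n (returnSeries a) ≤ 1 := by
  rw [returnSeries, PowerSeries.coeff_mk]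
  refine ⟨(ha.pow _ _).1, ((ha.pow _).coeff_le_mass _).trans ?_⟩
  rw [map_pow, hmass, one_pow]

lemma abs_coeff_mass_expInt_le (ha : NonnegOn s a) (hmass : mass ℝ a = 1) (t : Set ℝ) (n : ℕ) :
    |PowerSeries.coeff n (pairSeries (fun _ => 1) (expInt (-restrSeries t a)))| ≤ 1 := by
  rw [pairSeries_const_eq_map, map_expInt]
  refine abs_coeff_expInt_le (fun n => ?_) n
  rw [PowerSeries.coeff_map, map_neg, map_neg, abs_neg, restrSeries, PowerSeries.coeff_mk]
  have := mass_restr_mem ha hmass t (n + 1)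
  exact abs_le.2 ⟨(by norm_num : (-1 : ℝ) ≤ 0).trans this.1, this.2⟩

lemma pairSeries_sq_bound {P : PowerSeries (AddMonoidAlgebra ℝ ℝ)} {C₀ B r : ℝ}
    (hP : ∀ n, NonnegOn (Set.Icc (-C₀) C₀) (PowerSeries.coeff n P))
    (hB : ∀ n, |PowerSeries.coeff n (pairSeries (fun _ => 1) P)| ≤ B) (h0 : 0 ≤ r) (hr : r < 1) :
    (∀ n, |PowerSeries.coeff n (pairSeries (fun t => t ^ 2) P)| ≤ C₀ ^ 2 * B) ∧
    0 ≤ evalSeries r (pairSeries (fun t => t ^ 2) P) ∧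
    evalSeries r (pairSeries (fun t => t ^ 2) P) ≤
      C₀ ^ 2 * evalSeries r (pairSeries (fun _ => 1) P) := by
  have hr' : |r| < 1 := by rwa [abs_of_nonneg h0]
  have h1 : ∀ n, 0 ≤ PowerSeries.coeff n (pairSeries (fun t => t ^ 2) P) := fun n => by
    rw [coeff_pairSeries]; exact (hP n).pair_nonneg fun y _ => sq_nonneg y
  have h2 : ∀ n, PowerSeries.coeff n (pairSeries (fun t => t ^ 2) P) ≤
      C₀ ^ 2 * PowerSeries.coeff n (pairSeries (fun _ => 1) P) := fun n => by
    rw [coeff_pairSeries, coeff_pairSeries, ← pair_const_mul]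
    refine (hP n).pair_mono fun y hy => ?_
    nlinarith [hy.1, hy.2]
  have h3 : ∀ n, |PowerSeries.coeff n (pairSeries (fun t => t ^ 2) P)| ≤ C₀ ^ 2 * B := fun n => by
    rw [abs_of_nonneg (h1 n)]
    exact (h2 n).trans (mul_le_mul_of_nonneg_left ((le_abs_self _).trans (hB n)) (sq_nonneg _))
  refine ⟨h3, tsum_nonneg fun n => mul_nonneg (h1 n) (pow_nonneg h0 n), ?_⟩
  rw [evalSeries, evalSeries, ← tsum_mul_left]
  refine Summable.tsum_le_tsum (fun n => ?_) (summable_of_bounded h3 hr')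
    ((summable_of_bounded hB hr').mul_left _)
  rw [← mul_assoc]
  exact mul_le_mul_of_nonneg_right (h2 n) (pow_nonneg h0 n)

lemma pairSeries_id_bound {P : PowerSeries (AddMonoidAlgebra ℝ ℝ)} {C₀ B : ℝ} (hC : 0 ≤ C₀)
    (hP : ∀ n, NonnegOn (Set.Icc (-C₀) C₀) (PowerSeries.coeff n P))
    (hB : ∀ n, |PowerSeries.coeff n (pairSeries (fun _ => 1) P)| ≤ B) (n : ℕ) :
    |PowerSeries.coeff n (pairSeries (fun t => t) P)| ≤ C₀ * B := by
  have h0 := hB n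
  rw [coeff_pairSeries] at h0 ⊢
  have h := mul_le_mul_of_nonneg_left ((le_abs_self _).trans h0) hC
  have h1 := (hP n).pair_mono (φ := fun t => t) (ψ := fun _ => C₀ * 1) fun y hy => by simpa using hy.2
  have h2 := (hP n).pair_mono (φ := fun _ => (-C₀) * 1) (ψ := fun t => t)
    fun y hy => by simpa using hy.1
  rw [pair_const_mul] at h1 h2
  exact abs_le.2 ⟨by linarith, by linarith⟩

/-- Write f, g for the masses of the two ladder series at r, f₁, f₂, g₂ for the moments, and E for
exp(∑ P(X_n = 0) rⁿ/n). The factorization gives (1-f)(1-g) = 1-r and 1-g = E(1-f), so f and g tend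
to 1. Its second moment reads f₂(1-g) + 2E f₁² + (1-f)g₂ = σ²r. Ladder heights are bounded by C₀, so
f₂ and g₂ stay bounded, the outer terms vanish as r → 1, and 2E f₁² → σ² determines the mean. -/
theorem ladder_moments {C₀ : ℝ} (hC : 0 ≤ C₀) (ha : NonnegOn (Set.Icc (-C₀) C₀) a)
    (hsymm : reflect a = a) (hmass : mass ℝ a = 1) (hvar : 0 < pair (fun t => t ^ 2) a)
    (hsum : Summable fun n : ℕ => (a ^ (n + 1)).coeff 0 / (n + 1)) :
    HasSum (fun n => pair (fun _ => 1) (PowerSeries.coeff n (weakLadder a))) 1 ∧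
    HasSum (fun n => pair (fun _ => 1) (PowerSeries.coeff n (strictLadder a))) 1 ∧
    ∃ m : ℝ, 0 < m ∧
      m ^ 2 = pair (fun t => t ^ 2) a / 2 *
        Real.exp (-∑' n : ℕ, (a ^ (n + 1)).coeff 0 / (n + 1)) ∧
      HasSum (fun n => pair (fun t => t) (PowerSeries.coeff n (weakLadder a))) m := by
  set σ2 := pair (fun t => t ^ 2) a with hσ2
  set z := returnSeries a with hz
  set c := ∑' n : ℕ, (a ^ (n + 1)).coeff 0 / (n + 1) with hc
  set f := pairSeries (fun _ => 1) (weakLadder a) with hf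
  set g := pairSeries (fun _ => 1) (strictLadder a) with hg
  set f1 := pairSeries (fun t => t) (weakLadder a) with hf1
  set g1 := pairSeries (fun t => t) (strictLadder a) with hg1
  set f2 := pairSeries (fun t => t ^ 2) (weakLadder a) with hf2
  set g2 := pairSeries (fun t => t ^ 2) (strictLadder a) with hg2
  have hwl : ∀ n, NonnegOn (Set.Icc (-C₀) C₀) (PowerSeries.coeff n (weakLadder a)) := fun n =>
    (nonnegOn_weakLadder ha n).mono (Set.Icc_subset_Icc_left (by linarith))
  have hsl : ∀ n, NonnegOn (Set.Icc (-C₀) C₀) (PowerSeries.coeff n (strictLadder a)) := fun n =>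
    (nonnegOn_strictLadder ha n).mono fun y hy => ⟨hy.1, hy.2.le.trans hC⟩
  have hone : pairSeries (fun _ => 1) (1 : PowerSeries (AddMonoidAlgebra ℝ ℝ)) = 1 := by
    rw [pairSeries_one, one_smul]
  have hone1 : pairSeries (fun t => t) (1 : PowerSeries (AddMonoidAlgebra ℝ ℝ)) = 0 := by
    rw [pairSeries_one, zero_smul]
  have hone2 : pairSeries (fun t => t ^ 2) (1 : PowerSeries (AddMonoidAlgebra ℝ ℝ)) = 0 := by
    rw [pairSeries_one]; simp
  have bound : ∀ t : Set ℝ, ∀ n, |PowerSeries.coeff n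
      (pairSeries (fun _ => 1) (1 - expInt (-restrSeries t a)))| ≤ 1 := by
    intro t n
    cases n with
    | zero =>
      rw [map_sub, hone, map_sub, coeff_pairSeries, coeff_zero_expInt, pair_one]; simp
    | succ n =>
      rw [map_sub, hone, map_sub, PowerSeries.coeff_one, if_neg (by omega), zero_sub, abs_neg]
      exact abs_coeff_mass_expInt_le ha hmass t _
  have bf : ∀ n, |PowerSeries.coeff n f| ≤ 1 := bound _
  have bg : ∀ n, |PowerSeries.coeff n g| ≤ 1 := bound _
  have bf1 : ∀ n, |PowerSeries.coeff n f1| ≤ C₀ * 1 := pairSeries_id_bound hC hwl bf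
  have bg1 : ∀ n, |PowerSeries.coeff n g1| ≤ C₀ * 1 := pairSeries_id_bound hC hsl bg
  have bz : ∀ n, |PowerSeries.coeff n z| ≤ 1 := fun n => by
    have := coeff_returnSeries_mem ha hmass n
    exact abs_le.2 ⟨by linarith [this.1], this.2⟩
  have hE : expInt z * expInt (-z) = 1 := expInt_mul_neg z
  -- formal identities
  have id1 : (1 - f) * (1 - g) = 1 - C 1 * X := by
    have := congrArg (pairSeries fun _ => 1) (one_sub_ladder_mul a)
    rw [pairSeries_const_mul, map_sub, map_sub, hone, pairSeries_one_sub_C_mul_X, one_smul,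
      ← mass_apply, hmass] at this
    exact this
  have id2 : 1 - g = expInt z * (1 - f) := by
    have := congrArg (pairSeries fun _ => 1) (one_sub_weakLadder hsymm)
    rw [pairSeries_algebraMap_mul, pairSeries_map_reflect, map_sub, map_sub, hone] at this
    rw [hf, this, ← mul_assoc, hE, one_mul]
  have id3 : g1 = -(expInt z * f1) := by
    have := congrArg (pairSeries fun t => t) (one_sub_weakLadder hsymm)
    rw [pairSeries_algebraMap_mul, pairSeries_map_reflect, map_sub, map_sub, pairSeries_one,
      pairSeries_one, neg_zero, zero_smul, zero_sub, zero_sub] at this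
    have hneg : pairSeries (fun y => -y) (strictLadder a) = -g1 := by
      ext n
      rw [map_neg, hg1, coeff_pairSeries, coeff_pairSeries]
      have := pair_const_mul (-1) (fun y => y) (PowerSeries.coeff n (strictLadder a))
      simpa using this
    rw [hneg, neg_neg] at this
    have h2 : f1 = -(expInt (-z) * g1) := by rw [← this, neg_neg]
    rw [h2, mul_neg, neg_neg, ← mul_assoc, hE, one_mul]
  have id4 : f2 * (1 - g) + (expInt z * (f1 * f1) + expInt z * (f1 * f1)) + (1 - f) * g2 = C σ2 * X := by
    have := congrArg (pairSeries fun t => t ^ 2) (one_sub_ladder_mul a)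
    rw [pairSeries_sq_mul, pairSeries_one_sub_C_mul_X] at this
    simp only [map_sub, hone, hone1, hone2, zero_sub] at this
    rw [← hf2, ← hg2, ← hf1, ← hg1, ← hf, ← hg, ← hσ2, id3] at this
    simp only [nsmul_eq_mul, Nat.cast_ofNat] at this ⊢
    have h0 : ((0 : ℝ) ^ 2) • (1 : PowerSeries ℝ) = 0 := by simp
    rw [h0] at this
    linear_combination -this
  -- values
  have hnear : ∀ᶠ r : ℝ in 𝓝[<] 1, 0 < r ∧ r < 1 := Ioo_mem_nhdsLT one_pos
  have val : ∀ r : ℝ, 0 < r → r < 1 →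
      (1 - evalSeries r f) * (1 - evalSeries r g) = 1 - r ∧
      1 - evalSeries r g = Real.exp (evalSeries r (primitive z)) * (1 - evalSeries r f) ∧
      evalSeries r f2 * (1 - evalSeries r g) +
        2 * (Real.exp (evalSeries r (primitive z)) * (evalSeries r f1 * evalSeries r f1)) +
        (1 - evalSeries r f) * evalSeries r g2 = σ2 * r := by
    intro r h0 h1
    have hr : |r| < 1 := by rwa [abs_of_pos h0]
    have nf := summable_norm_of_bounded bf hr
    have ng := summable_norm_of_bounded bg hr
    have nf1 := summable_norm_of_bounded bf1 hr
    have nf2 := summable_norm_of_bounded (pairSeries_sq_bound hwl bf h0.le h1).1 hr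
    have ng2 := summable_norm_of_bounded (pairSeries_sq_bound hsl bg h0.le h1).1 hr
    have nE := summable_norm_of_bounded (abs_coeff_expInt_le bz) hr
    have nsub : ∀ {P : PowerSeries ℝ} {B : ℝ}, (∀ n, |PowerSeries.coeff n P| ≤ B) →
        Summable fun n => ‖PowerSeries.coeff n (1 - P) * r ^ n‖ := by
      intro P B hP
      refine summable_norm_of_bounded (B := 1 + B) (fun n => ?_) hr
      rw [map_sub]
      refine (abs_sub _ _).trans (add_le_add ?_ (hP n))
      rw [PowerSeries.coeff_one]; split_ifs <;> simp
    have nf' := nsub bf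
    have ng' := nsub bg
    refine ⟨?_, ?_, ?_⟩
    · have := congrArg (evalSeries r) id1
      rwa [evalSeries_mul nf' ng', evalSeries_one_sub nf, evalSeries_one_sub ng,
        evalSeries_one_sub (summable_norm_C_mul_X 1 r), evalSeries_C_mul_X, one_mul] at this
    · have := congrArg (evalSeries r) id2
      rwa [evalSeries_mul nE nf', evalSeries_one_sub nf, evalSeries_one_sub ng,
        evalSeries_expInt bz hr] at this
    · have := congrArg (evalSeries r) id4
      have nff := summable_norm_mul nf1 nf1
      have nEff := summable_norm_mul nE nff
      have n1 := summable_norm_mul nf2 ng'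
      have n2 := summable_norm_add nEff nEff
      rw [evalSeries_add (summable_norm_add n1 n2) (summable_norm_mul nf' ng2),
        evalSeries_add n1 n2, evalSeries_add nEff nEff, evalSeries_mul nf2 ng',
        evalSeries_mul nE nff, evalSeries_mul nf1 nf1, evalSeries_mul nf' ng2,
        evalSeries_one_sub nf, evalSeries_one_sub ng, evalSeries_expInt bz hr,
        evalSeries_C_mul_X] at this
      linarith
  -- limits
  have limc : Tendsto (fun r => evalSeries r (primitive z)) (𝓝[<] 1) (𝓝 c) := by
    have hs : HasSum (fun n => PowerSeries.coeff n (primitive z)) c := by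
      rw [← hasSum_nat_add_iff' 1]
      simp only [coeff_succ_primitive, Finset.range_one, Finset.sum_singleton,
        coeff_zero_primitive, sub_zero]
      simpa [hz, returnSeries] using hsum.hasSum
    exact Real.tendsto_tsum_powerSeries_nhdsWithin_lt hs.tendsto_sum_nat
  have limr : Tendsto (fun r : ℝ => r) (𝓝[<] 1) (𝓝 1) := nhdsWithin_le_nhds
  have limA : Tendsto (fun r => 1 - evalSeries r f) (𝓝[<] 1) (𝓝 0) := by
    -- Eliminating g from the two mass relations leaves (1-f)² = (1-r)/E.
    have h1 : Tendsto (fun r => √((1 - r) * Real.exp (-evalSeries r (primitive z)))) (𝓝[<] 1)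
        (𝓝 √((1 - 1) * Real.exp (-c))) := ((limr.const_sub 1).mul limc.neg.rexp).sqrt
    rw [sub_self, zero_mul, Real.sqrt_zero] at h1
    refine (tendsto_zero_iff_abs_tendsto_zero _).2 (h1.congr' ?_)
    filter_upwards [hnear] with r hr
    obtain ⟨h2, h3, -⟩ := val r hr.1 hr.2
    rw [← h2, h3, Function.comp_apply, ← Real.sqrt_sq_eq_abs, Real.exp_neg]
    congr 1
    field_simp
  have limB : Tendsto (fun r => 1 - evalSeries r g) (𝓝[<] 1) (𝓝 0) := by
    have h1 := limc.rexp.mul limA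
    rw [mul_zero] at h1
    refine h1.congr' ?_
    filter_upwards [hnear] with r hr
    exact (val r hr.1 hr.2).2.1.symm
  have limf : Tendsto (fun r => evalSeries r f) (𝓝[<] 1) (𝓝 1) := by
    simpa using limA.const_sub 1
  have limg : Tendsto (fun r => evalSeries r g) (𝓝[<] 1) (𝓝 1) := by
    simpa using limB.const_sub 1
  have lim2 : ∀ {P : PowerSeries (AddMonoidAlgebra ℝ ℝ)} {h : ℝ → ℝ},
      (∀ n, NonnegOn (Set.Icc (-C₀) C₀) (PowerSeries.coeff n P)) →
      (∀ n, |PowerSeries.coeff n (pairSeries (fun _ => 1) P)| ≤ 1) →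
      Tendsto (fun r => evalSeries r (pairSeries (fun _ => 1) P)) (𝓝[<] 1) (𝓝 1) →
      Tendsto h (𝓝[<] 1) (𝓝 0) →
      Tendsto (fun r => evalSeries r (pairSeries (fun t => t ^ 2) P) * h r) (𝓝[<] 1) (𝓝 0) := by
    intro P h hP hB h1 h2
    have h3 := (h1.const_mul (C₀ ^ 2)).mul h2.abs
    rw [abs_zero, mul_zero] at h3
    refine squeeze_zero_norm' ?_ h3
    filter_upwards [hnear] with r hr
    have := pairSeries_sq_bound hP hB hr.1.le hr.2
    rw [norm_mul, Real.norm_eq_abs, Real.norm_eq_abs, abs_of_nonneg this.2.1]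
    exact mul_le_mul_of_nonneg_right this.2.2 (abs_nonneg _)
  have pf1 : ∀ n, 0 ≤ PowerSeries.coeff n f1 := fun n => by
    rw [hf1, coeff_pairSeries]
    exact (nonnegOn_weakLadder ha n).pair_nonneg fun y hy => hy.1
  set l := σ2 / 2 * Real.exp (-c) with hl
  have hl0 : 0 < l := by positivity
  have limm : Tendsto (fun r => evalSeries r f1) (𝓝[<] 1) (𝓝 √l) := by
    have h1 := ((((limr.const_mul σ2).sub (lim2 hwl bf limf limB)).sub
      (lim2 hsl bg limg limA)).div_const 2).mul limc.neg.rexp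
    rw [mul_one, sub_zero, sub_zero, ← hl] at h1
    refine h1.sqrt.congr' ?_
    filter_upwards [hnear] with r hr
    have h2 := (val r hr.1 hr.2).2.2
    have h3 : 0 ≤ evalSeries r f1 := tsum_nonneg fun n => mul_nonneg (pf1 n) (pow_nonneg hr.1.le n)
    rw [← Real.sqrt_sq h3]
    congr 1
    rw [Real.exp_neg, ← div_eq_mul_inv, div_eq_iff (Real.exp_pos _).ne']
    linarith
  have sumf := hasSum_of_tendsto_evalSeries bf (fun n => by
    rw [hf, coeff_pairSeries]; exact (hwl n).pair_nonneg fun _ _ => zero_le_one) limf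
  have sumg := hasSum_of_tendsto_evalSeries bg (fun n => by
    rw [hg, coeff_pairSeries]; exact (hsl n).pair_nonneg fun _ _ => zero_le_one) limg
  have summ := hasSum_of_tendsto_evalSeries bf1 pf1 limm
  simp only [hf, hg, hf1, coeff_pairSeries] at sumf sumg summ
  exact ⟨sumf, sumg, √l, Real.sqrt_pos.2 hl0, Real.sq_sqrt hl0.le, summ⟩

end LadderMoments

/-! ### The renewal function: linear growth and harmonicity. -/

section RenewalFunction
open AddMonoidAlgebra Finset

/-- A maximum principle for subsolutions of a defective renewal equation. -/
lemma renewal_max_principle {K : AddMonoidAlgebra ℝ ℝ} {C₀ : ℝ} (hK : NonnegOn (Set.Icc 0 C₀) K)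
    (hmass : pair (fun _ => 1) K ≤ 1) {D : ℝ → ℝ} {T B δ : ℝ} (hδ : 0 < δ)
    (hB : ∀ t ∈ Set.Ioc 0 T, D t ≤ B) (h0 : ∀ t ∈ Set.Icc (-C₀) 0, D t ≤ 0)
    (hD : ∀ t ∈ Set.Ioc 0 T, D t ≤ pair (fun y => D (t - y)) K - δ) :
    ∀ t ∈ Set.Ioc 0 T, D t ≤ 0 := by
  by_contra! hcon
  obtain ⟨t₀, ht₀, hpos⟩ := hcon
  have hbdd : BddAbove (D '' Set.Ioc 0 T) := ⟨B, by rintro _ ⟨t, ht, rfl⟩; exact hB t ht⟩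
  set s := sSup (D '' Set.Ioc 0 T)
  have hs : ∀ t ∈ Set.Ioc 0 T, D t ≤ s := fun t ht => le_csSup hbdd ⟨t, ht, rfl⟩
  have hs0 : 0 < s := hpos.trans_le (hs t₀ ht₀)
  -- The supremum need not be attained; the slack δ makes a point within δ of it sufficient for a
  -- contradiction.
  obtain ⟨_, ⟨t, ht, rfl⟩, hlt⟩ := exists_lt_of_lt_csSup (⟨_, t₀, ht₀, rfl⟩ :
    (D '' Set.Ioc 0 T).Nonempty) (sub_lt_self s hδ)
  have h1 : pair (fun y => D (t - y)) K ≤ pair (fun _ => s * 1) K := by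
    refine hK.pair_mono fun y hy => ?_
    rw [mul_one]
    rcases le_or_gt (t - y) 0 with h | h
    · exact (h0 _ ⟨by linarith [ht.1, hy.2], h⟩).trans hs0.le
    · exact hs _ ⟨h, by linarith [ht.2, hy.1]⟩
  rw [pair_const_mul] at h1
  have := hD t ht
  nlinarith

/-- The indicator of `(-∞, t)`. -/
def ind (t y : ℝ) : ℝ := if y < t then 1 else 0

lemma ind_nonneg (t y : ℝ) : 0 ≤ ind t y := by unfold ind; split_ifs <;> norm_num

lemma ind_le_one (t y : ℝ) : ind t y ≤ 1 := by unfold ind; split_ifs <;> norm_num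

lemma ind_add (t y b : ℝ) : ind t (y + b) = ind (t - y) b := by
  unfold ind
  simp only [lt_sub_iff_add_lt']

variable (a : AddMonoidAlgebra ℝ ℝ)

/-- The coefficients of the renewal function. -/
def renewalCoeff (n : ℕ) (t : ℝ) : ℝ := pair (ind t) (PowerSeries.coeff n (weakRenewal a))

/-- The renewal function of the weak ascending ladder heights. -/
def renewalFun (t : ℝ) : ℝ := ∑' n, renewalCoeff a n t

lemma renewalCoeff_zero (t : ℝ) : renewalCoeff a 0 t = ind t 0 := by
  rw [renewalCoeff, weakRenewal, coeff_zero_expInt, pair_one]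

lemma renewalCoeff_succ (n : ℕ) (t : ℝ) : renewalCoeff a (n + 1) t =
    pair (fun y => renewalCoeff a n (t - y)) a
      - pair (ind t) (PowerSeries.coeff (n + 1) (strictLadder a)) := by
  rw [coeff_succ_strictLadder, map_sub, pair_mul]
  simp only [renewalCoeff, ind_add]
  ring

lemma renewalCoeff_eq (n : ℕ) (t : ℝ) : renewalCoeff a n t = (if n = 0 then ind t 0 else 0) +
    ∑ ij ∈ antidiagonal n,
      pair (fun y => renewalCoeff a ij.2 (t - y)) (PowerSeries.coeff ij.1 (weakLadder a)) := by
  have h : weakRenewal a = 1 + weakLadder a * weakRenewal a := by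
    linear_combination one_sub_weakLadder_mul a
  conv_lhs => rw [renewalCoeff, h]
  rw [map_add, map_add, PowerSeries.coeff_one, PowerSeries.coeff_mul, map_sum]
  congr 1
  · split_ifs
    · rw [pair_one]
    · rw [map_zero]
  · refine Finset.sum_congr rfl fun ij _ => ?_
    rw [pair_mul]
    simp only [renewalCoeff, ind_add]

variable {a} {C₀ : ℝ}

lemma renewalCoeff_nonneg {s : Set ℝ} (ha : NonnegOn s a) (n : ℕ) (t : ℝ) :
    0 ≤ renewalCoeff a n t :=
  (nonnegOn_weakRenewal ha n).pair_nonneg fun y _ => ind_nonneg t y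

lemma renewalCoeff_of_nonpos {s : Set ℝ} (ha : NonnegOn s a) (n : ℕ) {t : ℝ} (ht : t ≤ 0) :
    renewalCoeff a n t = 0 :=
  pair_eq_zero fun y hy => if_neg <| not_lt.2 <| ht.trans ((nonnegOn_weakRenewal ha n y).2 hy)

/-- This bound and the next compare truncated Cauchy products with products of partial sums. They
give renewal inequalities for partial sums before convergence of the renewal function is known. -/
lemma sum_range_sum_antidiagonal_le {h : ℕ × ℕ → ℝ} (hh : ∀ p, 0 ≤ h p) (N : ℕ) :
    ∑ n ∈ range N, ∑ p ∈ antidiagonal n, h p ≤ ∑ i ∈ range N, ∑ j ∈ range N, h (i, j) := by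
  have hset : ∑ n ∈ range N, ∑ p ∈ antidiagonal n, h p =
      ∑ p ∈ (range N ×ˢ range N).filter (fun p => p.1 + p.2 < N), h p := by
    rw [← Finset.sum_fiberwise_of_maps_to (t := range N) (g := fun p : ℕ × ℕ => p.1 + p.2)
      (by simp)]
    refine Finset.sum_congr rfl fun n hn => Finset.sum_congr ?_ fun _ _ => rfl
    ext p
    simp only [HasAntidiagonal.mem_antidiagonal, mem_filter, mem_product, mem_range] at hn ⊢
    omega
  rw [hset, ← Finset.sum_product' (f := fun i j => h (i, j))]
  exact Finset.sum_le_sum_of_subset_of_nonneg (filter_subset _ _) fun p _ _ => hh p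

lemma sum_range_sum_range_le {h : ℕ × ℕ → ℝ} (hh : ∀ p, 0 ≤ h p) (N N' : ℕ) :
    ∑ i ∈ range N, ∑ j ∈ range N', h (i, j) ≤
      ∑ n ∈ range (N + N'), ∑ p ∈ antidiagonal n, h p := by
  rw [← Finset.sum_product' (f := fun i j => h (i, j)),
    ← Finset.sum_fiberwise_of_maps_to (t := range (N + N')) (g := fun p : ℕ × ℕ => p.1 + p.2)
      (by simp only [mem_product, mem_range]; intro p hp; omega)]
  refine Finset.sum_le_sum fun n _ => Finset.sum_le_sum_of_subset_of_nonneg ?_ fun p _ _ => hh p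
  intro p
  simp only [HasAntidiagonal.mem_antidiagonal, mem_filter]
  exact fun h => h.2

lemma pair_sum_right (φ : ℝ → ℝ) (x : ℕ → AddMonoidAlgebra ℝ ℝ) (N : ℕ) :
    pair φ (∑ i ∈ range N, x i) = ∑ i ∈ range N, pair φ (x i) := map_sum _ _ _

lemma pair_sum_left (φ : ℕ → ℝ → ℝ) (x : AddMonoidAlgebra ℝ ℝ) (N : ℕ) :
    pair (fun y => ∑ i ∈ range N, φ i y) x = ∑ i ∈ range N, pair (φ i) x := by
  simp only [pair_apply, Finsupp.sum, Finset.mul_sum]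
  exact Finset.sum_comm

lemma pair_affine (A B e : ℝ) (ψ : ℝ → ℝ) (x : AddMonoidAlgebra ℝ ℝ) :
    pair (fun y => A + B * y + e * ψ y) x =
      A * pair (fun _ => 1) x + B * pair (fun t => t) x + e * pair ψ x := by
  simp only [pair_apply, Finsupp.sum, Finset.mul_sum, ← Finset.sum_add_distrib]
  exact Finset.sum_congr rfl fun y _ => by ring

lemma hasSum_pair {φ : ℕ → ℝ → ℝ} {ψ : ℝ → ℝ} (x : AddMonoidAlgebra ℝ ℝ)
    (h : ∀ y, HasSum (fun n => φ n y) (ψ y)) : HasSum (fun n => pair (φ n) x) (pair ψ x) := by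
  simp only [pair_apply, Finsupp.sum]
  exact hasSum_sum fun y _ => (h y).mul_left _

lemma tendsto_pair {φ : ℕ → ℝ → ℝ} {ψ : ℝ → ℝ} (x : AddMonoidAlgebra ℝ ℝ)
    (h : ∀ y, Tendsto (fun n => φ n y) atTop (𝓝 (ψ y))) :
    Tendsto (fun n => pair (φ n) x) atTop (𝓝 (pair ψ x)) := by
  simp only [pair_apply, Finsupp.sum]
  exact tendsto_finsetSum _ fun y _ => (h y).const_mul _

/-- The truncated weak ladder height distribution. -/
def ladderSum (a : AddMonoidAlgebra ℝ ℝ) (N : ℕ) : AddMonoidAlgebra ℝ ℝ :=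
  ∑ i ∈ range N, PowerSeries.coeff i (weakLadder a)

lemma nonnegOn_ladderSum (ha : NonnegOn (Set.Icc (-C₀) C₀) a) (N : ℕ) :
    NonnegOn (Set.Icc 0 C₀) (ladderSum a N) :=
  Finset.sum_induction _ (NonnegOn (Set.Icc 0 C₀)) (fun _ _ => .add) .zero
    fun i _ => nonnegOn_weakLadder ha i

lemma renewal_upper (ha : NonnegOn (Set.Icc (-C₀) C₀) a) (N : ℕ) (t : ℝ) :
    ∑ n ∈ range N, renewalCoeff a n t ≤
      1 + pair (fun y => ∑ n ∈ range N, renewalCoeff a n (t - y)) (ladderSum a N) := by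
  have h1 : ∀ N, ∑ n ∈ range N, (if n = 0 then ind t 0 else 0) ≤ 1 := by
    intro N
    rw [Finset.sum_ite_eq']
    split_ifs
    · exact ind_le_one t 0
    · norm_num
  rw [Finset.sum_congr rfl fun n _ => renewalCoeff_eq a n t, Finset.sum_add_distrib, ladderSum,
    pair_sum_right]
  simp only [pair_sum_left]
  exact add_le_add (h1 N) (sum_range_sum_antidiagonal_le (h := fun p =>
    pair (fun y => renewalCoeff a p.2 (t - y)) (PowerSeries.coeff p.1 (weakLadder a)))
    (fun p => (nonnegOn_weakLadder ha _).pair_nonneg fun y _ => renewalCoeff_nonneg ha _ _) N)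

/-- The form N' + 1 keeps the index 0 in the range, so the inhomogeneous term 1 is present. -/
lemma renewal_lower (ha : NonnegOn (Set.Icc (-C₀) C₀) a) (N N' : ℕ) {t : ℝ} (ht : 0 < t) :
    1 + pair (fun y => ∑ n ∈ range (N' + 1), renewalCoeff a n (t - y)) (ladderSum a N) ≤
      ∑ n ∈ range (N + (N' + 1)), renewalCoeff a n t := by
  rw [Finset.sum_congr rfl fun n _ => renewalCoeff_eq a n t, Finset.sum_add_distrib, ladderSum,
    pair_sum_right]
  simp only [pair_sum_left]
  refine add_le_add ?_ (sum_range_sum_range_le (h := fun p =>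
    pair (fun y => renewalCoeff a p.2 (t - y)) (PowerSeries.coeff p.1 (weakLadder a)))
    (fun p => (nonnegOn_weakLadder ha _).pair_nonneg fun y _ => renewalCoeff_nonneg ha _ _) N _)
  rw [Finset.sum_ite_eq', if_pos (by simp), ind, if_pos ht]

/-- Both linear bounds come from comparing with affine barriers through `renewal_max_principle`; the
upper one also yields convergence. Harmonicity is the sum over n of `renewalCoeff_succ`, whose
correction is the total strict ladder mass 1. -/
theorem renewalFun_spec {m : ℝ} (hC : 0 ≤ C₀) (ha : NonnegOn (Set.Icc (-C₀) C₀) a)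
    (hF : HasSum (fun n => pair (fun _ => 1) (PowerSeries.coeff n (weakLadder a))) 1)
    (hG : HasSum (fun n => pair (fun _ => 1) (PowerSeries.coeff n (strictLadder a))) 1)
    (hm : 0 < m) (hM : HasSum (fun n => pair (fun t => t) (PowerSeries.coeff n (weakLadder a))) m) :
    (∀ t ≤ 0, renewalFun a t = 0) ∧
    (∀ t > 0, t ≤ m * renewalFun a t ∧ m * renewalFun a t ≤ t + C₀) ∧
    ∀ t ≥ 0, pair (fun y => renewalFun a (t - y)) a = renewalFun a t + 1 - ind t 0 := by
  have hzero : ∀ t ≤ 0, renewalFun a t = 0 := fun t ht => by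
    simp [renewalFun, renewalCoeff_of_nonpos ha _ ht]
  have hK := fun N => nonnegOn_ladderSum (a := a) ha N
  have massK : ∀ N, pair (fun _ => 1) (ladderSum a N) ≤ 1 := fun N => by
    rw [ladderSum, pair_sum_right]
    exact sum_le_hasSum _ (fun i _ => (nonnegOn_weakLadder ha i).pair_nonneg
      fun _ _ => zero_le_one) hF
  have limmass : Tendsto (fun N => pair (fun _ => 1) (ladderSum a N)) atTop (𝓝 1) := by
    simp only [ladderSum, pair_sum_right]; exact hF.tendsto_sum_nat
  have limM : Tendsto (fun N => pair (fun t => t) (ladderSum a N)) atTop (𝓝 m) := by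
    simp only [ladderSum, pair_sum_right]; exact hM.tendsto_sum_nat
  have hpos : ∀ᶠ N in atTop, 0 < pair (fun t => t) (ladderSum a N) :=
    limM.eventually (lt_mem_nhds hm)
  have hnn := fun n t => renewalCoeff_nonneg (a := a) ha n t
  -- upper bound for partial sums
  have upper : ∀ N, 0 < pair (fun t => t) (ladderSum a N) → ∀ t > 0,
      ∑ n ∈ range N, renewalCoeff a n t ≤ (t + C₀) / pair (fun t => t) (ladderSum a N) := by
    intro N hN t ht
    set M := pair (fun t => t) (ladderSum a N) with hMdef
    -- The truncated renewal operator lowers the barrier (1+ε)(u + C₀)/M by at least 1+ε. The source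
    -- term uses 1, and ε is the slack of the maximum principle. The shift by C₀ keeps the barrier
    -- nonnegative on [-C₀, 0].
    have key : ∀ ε > 0, ∑ n ∈ range N, renewalCoeff a n t ≤ (1 + ε) * ((t + C₀) / M) := by
      intro ε hε
      have hWnn : ∀ u, -C₀ ≤ u → 0 ≤ (1 + ε) / M * (u + C₀) := fun u hu =>
        mul_nonneg (by positivity) (by linarith)
      have := renewal_max_principle (hK N) (massK N)
        (D := fun u => ∑ n ∈ range N, renewalCoeff a n u + -((1 + ε) / M) * (u + C₀))
        (T := t) (B := ∑ n ∈ range N, mass ℝ (PowerSeries.coeff n (weakRenewal a))) hε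
        ?_ ?_ ?_ t ⟨ht, le_rfl⟩
      · have h2 : (1 + ε) * ((t + C₀) / M) = (1 + ε) / M * (t + C₀) := by ring
        rw [h2]; linarith
      · intro u hu
        have h1 := hWnn u (by linarith [hu.1])
        have h2 : ∑ n ∈ range N, renewalCoeff a n u ≤
            ∑ n ∈ range N, mass ℝ (PowerSeries.coeff n (weakRenewal a)) :=
          Finset.sum_le_sum fun n _ =>
            (nonnegOn_weakRenewal ha n).pair_mono fun y _ => ind_le_one u y
        linarith
      · intro u hu
        have h1 := hWnn u hu.1
        have h2 : ∑ n ∈ range N, renewalCoeff a n u = 0 :=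
          Finset.sum_eq_zero fun n _ => renewalCoeff_of_nonpos ha n hu.2
        linarith
      · intro u hu
        have h1 := renewal_upper ha N u
        have h2 := hWnn u (by linarith [hu.1])
        have h3 : pair (fun y => ∑ n ∈ range N, renewalCoeff a n (u - y) +
            -((1 + ε) / M) * (u - y + C₀)) (ladderSum a N) =
            pair (fun y => ∑ n ∈ range N, renewalCoeff a n (u - y)) (ladderSum a N) +
            (-((1 + ε) / M) * (u + C₀) * pair (fun _ => 1) (ladderSum a N) + (1 + ε)) := by
          have h4 : (1 + ε) / M * M = 1 + ε := by field_simp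
          have h5 := pair_affine (-((1 + ε) / M) * (u + C₀)) ((1 + ε) / M) 1
            (fun y => ∑ n ∈ range N, renewalCoeff a n (u - y)) (ladderSum a N)
          rw [← hMdef, h4] at h5
          refine (pair_congr fun y _ => ?_).trans (h5.trans ?_) <;> ring
        rw [h3]
        have h5 := mul_le_mul_of_nonneg_left (massK N) h2
        linarith
    have lim : Tendsto (fun ε : ℝ => (1 + ε) * ((t + C₀) / M)) (𝓝[>] 0)
        (𝓝 ((1 + 0) * ((t + C₀) / M))) :=
      (Continuous.tendsto (by fun_prop) 0).mono_left nhdsWithin_le_nhds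
    rw [add_zero, one_mul] at lim
    exact ge_of_tendsto lim (eventually_nhdsWithin_of_forall key)
  have hsum : ∀ t, HasSum (fun n => renewalCoeff a n t) (renewalFun a t) := by
    intro t
    apply Summable.hasSum
    rcases le_or_gt t 0 with ht | ht
    · simp [renewalCoeff_of_nonpos ha _ ht, summable_zero]
    · obtain ⟨N₀, hN₀⟩ := hpos.exists_forall_of_atTop
      have hmono : ∀ N ≥ N₀, pair (fun t => t) (ladderSum a N₀) ≤
          pair (fun t => t) (ladderSum a N) := by
        intro N hN
        rw [ladderSum, ladderSum, pair_sum_right, pair_sum_right]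
        exact Finset.sum_le_sum_of_subset_of_nonneg (range_mono hN)
          fun i _ _ => (nonnegOn_weakLadder ha i).pair_nonneg fun y hy => hy.1
      refine summable_of_sum_range_le (c := (t + C₀) / pair (fun t => t) (ladderSum a N₀))
        (fun n => hnn n t) fun N => ?_
      have h1 : ∑ n ∈ range N, renewalCoeff a n t ≤ ∑ n ∈ range (max N N₀), renewalCoeff a n t :=
        Finset.sum_le_sum_of_subset_of_nonneg (range_mono (le_max_left _ _)) fun i _ _ => hnn i t
      have h2 := upper _ (hN₀ _ (le_max_right N N₀)) t ht
      exact h1.trans (h2.trans (div_le_div_of_nonneg_left (by linarith) (hN₀ _ le_rfl)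
        (hmono _ (le_max_right _ _))))
  refine ⟨hzero, fun t ht => ⟨?_, ?_⟩, fun t ht => ?_⟩
  · -- lower bound
    have hren : ∀ N, ∀ u > 0, 1 + pair (fun y => renewalFun a (u - y)) (ladderSum a N) ≤
        renewalFun a u := by
      intro N u hu
      have h1 : Tendsto (fun N' => 1 + pair (fun y => ∑ n ∈ range (N' + 1),
          renewalCoeff a n (u - y)) (ladderSum a N)) atTop
          (𝓝 (1 + pair (fun y => renewalFun a (u - y)) (ladderSum a N))) :=
        (tendsto_pair _ fun y => (tendsto_add_atTop_iff_nat 1).2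
          (hsum (u - y)).tendsto_sum_nat).const_add 1
      exact le_of_tendsto' h1 fun N' => (renewal_lower ha N N' hu).trans
        (sum_le_hasSum _ (fun i _ => hnn i u) (hsum u))
    have hV0 : ∀ u, 0 ≤ renewalFun a u := fun u => tsum_nonneg fun n => hnn n u
    have key : ∀ κ : ℝ, 0 < κ → κ < 1 → κ * t ≤ m * renewalFun a t := by
      intro κ hκ0 hκ1
      have lim : Tendsto (fun N => κ / m * t * (1 - pair (fun _ => 1) (ladderSum a N)) +
          κ / m * pair (fun t => t) (ladderSum a N)) atTop
          (𝓝 (κ / m * t * (1 - 1) + κ / m * m)) :=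
        ((limmass.const_sub 1).const_mul _).add (limM.const_mul _)
      rw [sub_self, mul_zero, zero_add, div_mul_cancel₀ _ hm.ne'] at lim
      -- For the barrier of slope κ/m the defect caused by truncation tends to κ < 1; keeping it
      -- below (1+κ)/2 leaves the slack (1-κ)/2.
      obtain ⟨N, hN⟩ := (lim.eventually (gt_mem_nhds (by linarith : κ < (1 + κ) / 2))).exists
      have hα : 0 < κ / m := by positivity
      have := renewal_max_principle (hK N) (massK N)
        (D := fun u => κ / m * u + -1 * renewalFun a u) (T := t) (B := κ / m * t)
        (δ := (1 - κ) / 2) (by linarith) ?_ ?_ ?_ t ⟨ht, le_rfl⟩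
      · have h1 : κ / m * t ≤ renewalFun a t := by linarith
        rwa [div_mul_eq_mul_div, div_le_iff₀ hm, mul_comm (renewalFun a t)] at h1
      · intro u hu
        have := hV0 u
        have := mul_le_mul_of_nonneg_left hu.2 hα.le
        linarith
      · intro u hu
        rw [hzero u hu.2]
        have := mul_nonpos_of_nonneg_of_nonpos hα.le hu.2
        linarith
      · intro u hu
        have h1 := hren N u hu.1
        have h3 : pair (fun y => κ / m * (u - y) + -1 * renewalFun a (u - y)) (ladderSum a N) =
            (κ / m * u * pair (fun _ => 1) (ladderSum a N)
              + -(κ / m) * pair (fun t => t) (ladderSum a N)) +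
            -1 * pair (fun y => renewalFun a (u - y)) (ladderSum a N) := by
          rw [← pair_affine]
          exact pair_congr fun y _ => by ring
        rw [h3]
        have h4 : κ / m * u * (1 - pair (fun _ => 1) (ladderSum a N)) ≤
            κ / m * t * (1 - pair (fun _ => 1) (ladderSum a N)) :=
          mul_le_mul_of_nonneg_right (mul_le_mul_of_nonneg_left hu.2 hα.le)
            (by linarith [massK N])
        linarith
    have lim : Tendsto (fun κ : ℝ => κ * t) (𝓝[<] 1) (𝓝 (1 * t)) :=
      (Continuous.tendsto (by fun_prop) 1).mono_left nhdsWithin_le_nhds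
    rw [one_mul] at lim
    refine le_of_tendsto lim ?_
    filter_upwards [Ioo_mem_nhdsLT (one_pos : (0 : ℝ) < 1)] with κ hκ
    exact key κ hκ.1 hκ.2
  · have h1 : Tendsto (fun N => (t + C₀) / pair (fun t => t) (ladderSum a N)) atTop
        (𝓝 ((t + C₀) / m)) := tendsto_const_nhds.div limM hm.ne'
    have h2 := le_of_tendsto_of_tendsto (hsum t).tendsto_sum_nat h1
      (hpos.mono fun N hN => upper N hN t ht)
    rwa [le_div_iff₀ hm, mul_comm] at h2
  · -- harmonicity
    have h1 : HasSum (fun n => pair (fun y => renewalCoeff a n (t - y)) a)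
        (pair (fun y => renewalFun a (t - y)) a) := hasSum_pair a fun y => hsum (t - y)
    have h2 : HasSum (fun n => pair (ind t) (PowerSeries.coeff (n + 1) (strictLadder a))) 1 := by
      have := (hasSum_nat_add_iff' 1).2 hG
      simp only [Finset.range_one, Finset.sum_singleton, coeff_zero_strictLadder, map_zero,
        sub_zero] at this
      refine this.congr_fun fun n => ?_
      -- Strict descending heights are negative, so for t ≥ 0 the indicator sees their full mass.
      refine pair_congr fun y hy => if_pos ?_
      exact ((nonnegOn_strictLadder ha (n + 1) y).2 hy).2.trans_le ht
    have h3 : HasSum (fun n => renewalCoeff a (n + 1) t) (renewalFun a t - ind t 0) := by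
      have := (hasSum_nat_add_iff' 1).2 (hsum t)
      simpa [renewalCoeff_zero] using this
    simp only [renewalCoeff_succ] at h3
    have := h3.unique (h1.sub h2)
    linarith

end RenewalFunction

/-! ### Uniqueness for the half-space problem. -/

section Uniqueness

variable {p : EuclideanSpace ℝ (Fin 2)}

lemma slopeDot_add_single (p : EuclideanSpace ℝ (Fin 2)) (x : Fin 2 → ℤ) (i : Fin 2) :
    slopeDot p (x + Pi.single i 1) = slopeDot p x + p i := by
  fin_cases i <;> simp [slopeDot, Fin.sum_univ_two] <;> ring

lemma slopeDot_sub_single (p : EuclideanSpace ℝ (Fin 2)) (x : Fin 2 → ℤ) (i : Fin 2) :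
    slopeDot p (x - Pi.single i 1) = slopeDot p x - p i := by
  fin_cases i <;> simp [slopeDot, Fin.sum_univ_two] <;> ring

lemma sum_sq_pos (hp : p ≠ 0) : 0 < p 0 ^ 2 + p 1 ^ 2 := by
  have h : 0 < ‖p‖ ^ 2 := by positivity
  rwa [EuclideanSpace.norm_sq_eq, Fin.sum_univ_two, Real.norm_eq_abs, Real.norm_eq_abs, sq_abs,
    sq_abs] at h

/-- A maximum principle for strict subsolutions on a strip. -/
lemma strip_max_principle {v : (Fin 2 → ℤ) → ℝ} {L c K B η : ℝ} (hη : 0 < η)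
    (hc : ∀ i, |p i| ≤ c)
    (hB : ∀ x, 0 < slopeDot p x → slopeDot p x < L → v x ≤ B)
    (hlow : ∀ x, -c ≤ slopeDot p x → slopeDot p x ≤ 0 → v x ≤ K)
    (hhigh : ∀ x, L ≤ slopeDot p x → slopeDot p x ≤ L + c → v x ≤ K)
    (hv : ∀ x, 0 < slopeDot p x → slopeDot p x < L → 4 * η ≤ latticeLaplacian v x) :
    ∀ x, 0 < slopeDot p x → slopeDot p x < L → v x ≤ K := by
  by_contra! hcon
  obtain ⟨x₀, h₀, h₀', hlt⟩ := hcon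
  set D : Set (Fin 2 → ℤ) := {x | 0 < slopeDot p x ∧ slopeDot p x < L}
  have hbdd : BddAbove (v '' D) := ⟨B, by rintro _ ⟨x, hx, rfl⟩; exact hB x hx.1 hx.2⟩
  set s := sSup (v '' D)
  have hs : ∀ x ∈ D, v x ≤ s := fun x hx => le_csSup hbdd ⟨x, hx, rfl⟩
  have hKs : K ≤ s := hlt.le.trans (hs x₀ ⟨h₀, h₀'⟩)
  -- The strip is infinite, so a near-maximum replaces a maximum: four neighbours at most s and a
  -- centre above s - η force a Laplacian below 4η.
  obtain ⟨_, ⟨x, hx, rfl⟩, hxs⟩ := exists_lt_of_lt_csSup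
    (⟨_, x₀, ⟨h₀, h₀'⟩, rfl⟩ : (v '' D).Nonempty) (sub_lt_self s hη)
  have key : ∀ y, slopeDot p x - c ≤ slopeDot p y → slopeDot p y ≤ slopeDot p x + c → v y ≤ s := by
    intro y h1 h2
    rcases le_or_gt (slopeDot p y) 0 with h | h
    · exact (hlow y (by linarith [hx.1]) h).trans hKs
    · rcases le_or_gt L (slopeDot p y) with h' | h'
      · exact (hhigh y h' (by linarith [hx.2])).trans hKs
      · exact hs y ⟨h, h'⟩
  have hadd : ∀ i, v (x + Pi.single i 1) ≤ s := fun i => by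
    have := abs_le.1 (hc i)
    apply key <;> rw [slopeDot_add_single] <;> linarith
  have hsub : ∀ i, v (x - Pi.single i 1) ≤ s := fun i => by
    have := abs_le.1 (hc i)
    apply key <;> rw [slopeDot_sub_single] <;> linarith
  have h1 := hv x hx.1 hx.2
  rw [latticeLaplacian, Fin.sum_univ_two] at h1
  linarith [hadd 0, hadd 1, hsub 0, hsub 1]

/-- On the strip 0 < p·x < L, `w` is compared with the harmonic function M(p·x)/L. The term δ(p·x)²
has Laplacian 2δ|p|² and supplies strictness, while Mc/L pays for jumps across the lower edge. Let δ
→ 0, then L → ∞. -/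
lemma nonpos_of_bounded_harmonic (hp : p ≠ 0) {w : (Fin 2 → ℤ) → ℝ} {M : ℝ} (hM : 0 ≤ M)
    (hb : ∀ x, 0 < slopeDot p x → w x ≤ M) (h0 : ∀ x, slopeDot p x ≤ 0 → w x = 0)
    (hh : ∀ x, 0 < slopeDot p x → latticeLaplacian w x = 0) (x : Fin 2 → ℤ)
    (hx : 0 < slopeDot p x) : w x ≤ 0 := by
  set c := |p 0| + |p 1|
  have hc0 : 0 ≤ c := by positivity
  have hc : ∀ i, |p i| ≤ c := by
    intro i; fin_cases i <;> simp [c]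
  have hp2 := sum_sq_pos hp
  have h1 : ∀ L > slopeDot p x, ∀ δ > 0,
      w x ≤ M * slopeDot p x / L + M * c / L + δ * (L + c) ^ 2 := by
    intro L hL δ hδ
    have hL0 : 0 < L := hx.trans hL
    have := strip_max_principle (p := p) (L := L) (c := c) (B := M + δ * L ^ 2)
      (K := M * c / L + δ * (L + c) ^ 2)
      (v := fun x => w x - M * slopeDot p x / L + δ * slopeDot p x ^ 2)
      (η := δ * (p 0 ^ 2 + p 1 ^ 2) / 2) (by positivity) hc ?_ ?_ ?_ ?_ x hx hL
    · have h2 : 0 ≤ δ * slopeDot p x ^ 2 := by positivity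
      linarith
    · intro y hy hyL
      have h2 : 0 ≤ M * slopeDot p y / L := by positivity
      have h3 : δ * slopeDot p y ^ 2 ≤ δ * L ^ 2 := by gcongr
      linarith [hb y hy]
    · intro y hy hy0
      have h2 : δ * slopeDot p y ^ 2 ≤ δ * (L + c) ^ 2 :=
        mul_le_mul_of_nonneg_left (sq_le_sq' (by linarith) (by linarith)) hδ.le
      have h3 : -(M * slopeDot p y / L) ≤ M * c / L := by
        rw [← neg_div]
        gcongr
        rw [← mul_neg]
        exact mul_le_mul_of_nonneg_left (by linarith) hM
      simp only [h0 y hy0]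
      linarith
    · intro y hy hyL
      have h2 : δ * slopeDot p y ^ 2 ≤ δ * (L + c) ^ 2 :=
        mul_le_mul_of_nonneg_left (sq_le_sq' (by linarith) (by linarith)) hδ.le
      have h3 : M ≤ M * slopeDot p y / L := by
        rw [le_div_iff₀ hL0]; gcongr
      have h4 : 0 ≤ M * c / L := by positivity
      linarith [hb y (hL0.trans_le hy)]
    · intro y hy hyL
      have h2 := hh y hy
      rw [latticeLaplacian, Fin.sum_univ_two] at h2 ⊢
      simp only [slopeDot_add_single, slopeDot_sub_single]
      have h3 : ∀ u : ℝ, M * u / L = M / L * u := fun u => by ring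
      simp only [h3]
      refine le_of_eq ?_
      linear_combination -h2
  have h2 : ∀ L > slopeDot p x, w x ≤ (M * slopeDot p x + M * c) / L := by
    intro L hL
    have lim : Tendsto (fun δ : ℝ => M * slopeDot p x / L + M * c / L + δ * (L + c) ^ 2) (𝓝[>] 0)
        (𝓝 (M * slopeDot p x / L + M * c / L + 0 * (L + c) ^ 2)) :=
      (Continuous.tendsto (by fun_prop) 0).mono_left nhdsWithin_le_nhds
    rw [zero_mul, add_zero, ← add_div] at lim
    exact ge_of_tendsto lim (eventually_nhdsWithin_of_forall fun δ hδ => by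
      have := h1 L hL δ hδ
      rwa [← add_div] at this)
  exact ge_of_tendsto (tendsto_const_nhds.div_atTop tendsto_id)
    ((eventually_gt_atTop _).mono h2)

lemma latticeLaplacian_sub (u v : (Fin 2 → ℤ) → ℝ) (x : Fin 2 → ℤ) :
    latticeLaplacian (fun y => u y - v y) x = latticeLaplacian u x - latticeLaplacian v x := by
  simp only [latticeLaplacian, Fin.sum_univ_two]
  ring

theorem IsHalfSpaceSolution.unique (hp : p ≠ 0) {u v : (Fin 2 → ℤ) → ℝ}
    (hu : IsHalfSpaceSolution p u) (hv : IsHalfSpaceSolution p v) : u = v := by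
  have key : ∀ {u v : (Fin 2 → ℤ) → ℝ}, IsHalfSpaceSolution p u → IsHalfSpaceSolution p v →
      ∀ x, u x ≤ v x := by
    intro u v hu hv x
    rcases le_or_gt (slopeDot p x) 0 with h | h
    · rw [hu.zero x h, hv.zero x h]
    · obtain ⟨B, hB⟩ := hu.bounded
      obtain ⟨B', hB'⟩ := hv.bounded
      have h1 : ∀ x, 0 < slopeDot p x → u x - v x ≤ B + B' := fun x hx => by
        have h2 := abs_le.1 (hB x hx)
        have h3 := abs_le.1 (hB' x hx)
        linarith
      have hBB : 0 ≤ B + B' := add_nonneg ((abs_nonneg _).trans (hB x h))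
        ((abs_nonneg _).trans (hB' x h))
      exact sub_nonpos.1 (nonpos_of_bounded_harmonic (w := fun y => u y - v y) hp hBB h1
        (fun y hy => by rw [hu.zero y hy, hv.zero y hy, sub_zero])
        (fun y hy => by rw [latticeLaplacian_sub, hu.harmonic y hy, hv.harmonic y hy, sub_zero])
        x h)
  exact funext fun x => (key hu hv x).antisymm (key hv hu x)

end Uniqueness

/-! ### The solution of the half-space problem and the value of H. -/

section StepLaw
open AddMonoidAlgebra

/-- The law of a step `p · S₁` of the projected simple random walk. -/
def stepLaw (p : EuclideanSpace ℝ (Fin 2)) : AddMonoidAlgebra ℝ ℝ :=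
  ∑ i, (single (p i) (1 / 4) + single (-p i) (1 / 4))

lemma pair_stepLaw (p : EuclideanSpace ℝ (Fin 2)) (φ : ℝ → ℝ) :
    pair φ (stepLaw p) = 1 / 4 * ∑ i, (φ (p i) + φ (-p i)) := by
  simp only [stepLaw, map_sum, map_add, pair_single, Finset.mul_sum, mul_add]

lemma nonnegOn_single {M : Type*} {s : Set M} {y : M} (hy : y ∈ s) {c : ℝ} (hc : 0 ≤ c) :
    NonnegOn s (single y c) := by
  classical
  intro z
  rw [coeff_single, Finsupp.single_apply]
  split_ifs with h
  · exact ⟨hc, fun _ => h ▸ hy⟩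
  · simp

lemma nonnegOn_stepLaw (p : EuclideanSpace ℝ (Fin 2)) :
    NonnegOn (Set.Icc (-(|p 0| + |p 1|)) (|p 0| + |p 1|)) (stepLaw p) := by
  have h : ∀ i, |p i| ≤ |p 0| + |p 1| := by intro i; fin_cases i <;> simp
  refine Finset.sum_induction _ (NonnegOn (Set.Icc (-(|p 0| + |p 1|)) (|p 0| + |p 1|)))
    (fun _ _ => .add) .zero fun i _ => ?_
  have := abs_le.1 (h i)
  have h1 : p i ∈ Set.Icc (-(|p 0| + |p 1|)) (|p 0| + |p 1|) := this
  have h2 : -p i ∈ Set.Icc (-(|p 0| + |p 1|)) (|p 0| + |p 1|) := ⟨by linarith, by linarith⟩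
  exact (nonnegOn_single h1 (by norm_num)).add (nonnegOn_single h2 (by norm_num))

lemma reflect_stepLaw (p : EuclideanSpace ℝ (Fin 2)) : reflect (stepLaw p) = stepLaw p := by
  simp only [stepLaw, map_sum, map_add, reflect_single, neg_neg]
  exact Finset.sum_congr rfl fun i _ => add_comm _ _

lemma mass_stepLaw (p : EuclideanSpace ℝ (Fin 2)) : mass ℝ (stepLaw p) = 1 := by
  rw [mass_apply, pair_stepLaw, Fin.sum_univ_two]; norm_num

lemma variance_stepLaw (p : EuclideanSpace ℝ (Fin 2)) :
    pair (fun t => t ^ 2) (stepLaw p) = ‖p‖ ^ 2 / 2 := by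
  rw [pair_stepLaw, EuclideanSpace.norm_sq_eq, Fin.sum_univ_two, Fin.sum_univ_two]
  simp only [Real.norm_eq_abs, sq_abs]
  ring

/-- With u = mV(p·x) each neighbour has weight 1/4, so the Laplacian at 0 is 4m and its square is
16m², where the step variance is |p|²/2. -/
theorem exists_halfSpaceSolution {p : EuclideanSpace ℝ (Fin 2)} (hp : p ≠ 0)
    (hsum : Summable fun n : ℕ => (stepLaw p ^ (n + 1)).coeff 0 / (n + 1)) :
    ∃ u, IsHalfSpaceSolution p u ∧ latticeLaplacian u 0 ^ 2 =
      4 * Real.exp (-∑' n : ℕ, (stepLaw p ^ (n + 1)).coeff 0 / (n + 1)) * ‖p‖ ^ 2 := by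
  have hC : 0 ≤ |p 0| + |p 1| := by positivity
  have ha := nonnegOn_stepLaw p
  have hpos : 0 < ‖p‖ := norm_pos_iff.2 hp
  obtain ⟨hF, hG, m, hm, hm2, hM⟩ := ladder_moments hC ha (reflect_stepLaw p) (mass_stepLaw p)
    (by rw [variance_stepLaw]; positivity) hsum
  obtain ⟨h0, hlin, hharm⟩ := renewalFun_spec hC ha hF hG hm hM
  set V := renewalFun (stepLaw p)
  have hlap : ∀ x, 0 ≤ slopeDot p x →
      latticeLaplacian (fun y => m * V (slopeDot p y)) x =
        4 * m * (1 - ind (slopeDot p x) 0) := by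
    intro x hx
    have h1 := hharm _ hx
    rw [pair_stepLaw, Fin.sum_univ_two] at h1
    simp only [latticeLaplacian, Fin.sum_univ_two, slopeDot_add_single, slopeDot_sub_single,
      sub_neg_eq_add] at h1 ⊢
    linear_combination 4 * m * h1
  refine ⟨fun y => m * V (slopeDot p y), ⟨fun x hx => ?_, fun x hx => ?_,
    |p 0| + |p 1|, fun x hx => ?_⟩, ?_⟩
  · rw [hlap x hx.le, ind, if_pos hx]; ring
  · simp only [h0 _ hx, mul_zero]
  · have := hlin _ hx
    rw [abs_of_nonneg (by linarith [this.1])]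
    linarith [this.2]
  · have hz : slopeDot p 0 = 0 := by simp [slopeDot]
    rw [hlap 0 hz.ge, hz, ind, if_neg (lt_irrefl _)]
    rw [variance_stepLaw] at hm2
    linear_combination 16 * hm2

/-- Uniqueness makes the choice by `Classical.epsilon` immaterial. -/
theorem latticeHamiltonian_eq {p : EuclideanSpace ℝ (Fin 2)} (hp : p ≠ 0)
    (u : (Fin 2 → ℤ) → ℝ) (hu : IsHalfSpaceSolution p u) :
    latticeHamiltonian p = latticeLaplacian u 0 := by
  rw [latticeHamiltonian]
  congr 1
  exact IsHalfSpaceSolution.unique hp (Classical.epsilon_spec ⟨u, hu⟩) hu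

end StepLaw

/-! ### A bound n^(-1/2) on return probabilities, uniform in the slope. -/

section ReturnBound
open AddMonoidAlgebra

/-- Passing from m to m+1 multiplies the left side by (2m+1)(2m+3)/(2m+2)² ≤ 1. -/
lemma sq_centralBinom_le (m : ℕ) : ((m.centralBinom : ℝ) / 4 ^ m) ^ 2 * (2 * m + 1) ≤ 1 := by
  induction m with
  | zero => simp
  | succ m ih =>
    have h := Nat.succ_mul_centralBinom_succ m
    have h' : ((m : ℝ) + 1) * (m + 1).centralBinom = 2 * (2 * m + 1) * m.centralBinom := by
      exact_mod_cast h
    have h2 : ((m + 1).centralBinom : ℝ) / 4 ^ (m + 1) =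
        (2 * m + 1) / (2 * (m + 1)) * (m.centralBinom / 4 ^ m) := by
      rw [pow_succ]
      field_simp
      linear_combination 2 * h'
    rw [h2]
    push_cast
    have h3 : ((2 * (m : ℝ) + 1) / (2 * (m + 1)) * (m.centralBinom / 4 ^ m)) ^ 2 *
        (2 * (m + 1) + 1) = ((m.centralBinom : ℝ) / 4 ^ m) ^ 2 * (2 * m + 1) *
        ((2 * m + 1) * (2 * m + 3) / (2 * (m + 1)) ^ 2) := by
      field_simp
      ring
    rw [h3]
    refine mul_le_one₀ ih (by positivity) ?_
    rw [div_le_one (by positivity)]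
    nlinarith

lemma choose_half_div_le (n : ℕ) (hn : 0 < n) :
    (n.choose (n / 2) : ℝ) / 2 ^ n ≤ 1 / √n := by
  have key : ((n.choose (n / 2) : ℝ) / 2 ^ n) ^ 2 * n ≤ 1 := by
    have hmono : ∀ m : ℕ, ((m.centralBinom : ℝ) / 4 ^ m) ^ 2 * (2 * m + 1) ≤ 1 :=
      sq_centralBinom_le
    rcases Nat.even_or_odd' n with ⟨m, rfl | rfl⟩
    · have h1 : 2 * m / 2 = m := by omega
      rw [h1, ← Nat.centralBinom_eq_two_mul_choose, pow_mul]
      norm_num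
      exact (mul_le_mul_of_nonneg_left (by linarith) (sq_nonneg _)).trans (hmono m)
    · have h1 : (2 * m + 1) / 2 = m := by omega
      have h2 : ((2 * m + 1).choose m : ℝ) ≤ 2 * m.centralBinom := by
        have : (2 * m + 1).choose m ≤ 2 * m.centralBinom := by
          cases m with
          | zero => simp
          | succ k =>
            rw [Nat.choose_succ_succ']
            have := Nat.choose_le_centralBinom k (k + 1)
            have := Nat.choose_le_centralBinom (k + 1) (k + 1)
            omega
        exact_mod_cast this
      have h3 : ((2 * m + 1).choose m : ℝ) / 2 ^ (2 * m + 1) ≤ m.centralBinom / 4 ^ m := by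
        have h4 : (2 : ℝ) ^ (2 * m + 1) = 4 ^ m * 2 := by rw [pow_succ, pow_mul]; norm_num
        rw [h4, div_le_div_iff₀ (by positivity) (by positivity)]
        nlinarith [pow_pos (by norm_num : (0 : ℝ) < 4) m]
      rw [h1]
      refine le_trans (mul_le_mul (pow_le_pow_left₀ (by positivity) h3 2) ?_ (by positivity)
        (by positivity)) (hmono m)
      push_cast
      exact le_rfl
  have hn' : (0 : ℝ) < n := by exact_mod_cast hn
  rw [le_div_iff₀ (Real.sqrt_pos.2 hn')]
  refine le_of_sq_le_sq ?_ zero_le_one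
  rw [mul_pow, Real.sq_sqrt hn'.le, one_pow]
  exact key

/-- The law of a fair sign times `s`. -/
def coin (s : ℝ) : AddMonoidAlgebra ℝ ℝ := single s (1 / 2) + single (-s) (1 / 2)

lemma nonnegOn_coin (s : ℝ) : NonnegOn Set.univ (coin s) :=
  (nonnegOn_single (Set.mem_univ _) (by norm_num)).add (nonnegOn_single (Set.mem_univ _) (by norm_num))

lemma mass_coin_pow (s : ℝ) (n : ℕ) : mass ℝ (coin s ^ n) = 1 := by
  rw [map_pow, coin, mass_apply, map_add, pair_single, pair_single]
  norm_num

/-- For s ≠ 0 different numbers of heads end at different points, so each atom is a single binomial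
weight, at most the middle one. -/
lemma coeff_coin_pow_le {s : ℝ} (hs : s ≠ 0) (n : ℕ) (hn : 0 < n) (z : ℝ) :
    (coin s ^ n).coeff z ≤ 1 / √n := by
  classical
  have h0 : 0 ≤ 1 / √(n : ℝ) := by positivity
  have hexp : (coin s ^ n).coeff z = ∑ m ∈ Finset.range (n + 1),
      if (m : ℝ) * s - ((n - m : ℕ) : ℝ) * s = z then (n.choose m : ℝ) / 2 ^ n else 0 := by
    rw [coin, add_pow, coeff_sum, Finset.sum_apply']
    refine Finset.sum_congr rfl fun m hm => ?_
    have hm' : m ≤ n := Nat.lt_succ_iff.1 (Finset.mem_range.1 hm)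
    rw [single_pow, single_pow, single_mul_single, mul_comm, ← nsmul_eq_mul, coeff_smul,
      Finsupp.smul_apply, coeff_single, Finsupp.single_apply, ← pow_add, Nat.add_sub_cancel' hm']
    have : m • s + (n - m) • -s = (m : ℝ) * s - ((n - m : ℕ) : ℝ) * s := by
      simp only [nsmul_eq_mul]; ring
    rw [this]
    split_ifs
    · rw [nsmul_eq_mul]; simp [div_eq_mul_inv]
    · simp
  rw [hexp]
  by_cases hz : ∃ m ∈ Finset.range (n + 1), (m : ℝ) * s - ((n - m : ℕ) : ℝ) * s = z
  · obtain ⟨m, hm, hmz⟩ := hz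
    rw [Finset.sum_eq_single m, if_pos hmz]
    · refine le_trans ?_ (choose_half_div_le n hn)
      gcongr
      exact Nat.choose_le_middle m n
    · intro k hk hkm
      rw [if_neg]
      intro hkz
      apply hkm
      have h1 : ((m : ℝ) - ((n - m : ℕ) : ℝ)) * s = ((k : ℝ) - ((n - k : ℕ) : ℝ)) * s := by
        linarith
      have h2 := mul_right_cancel₀ hs h1
      rw [Nat.cast_sub (Nat.lt_succ_iff.1 (Finset.mem_range.1 hm)),
        Nat.cast_sub (Nat.lt_succ_iff.1 (Finset.mem_range.1 hk))] at h2
      have h3 : (k : ℝ) = m := by linarith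
      exact_mod_cast h3
    · exact fun h => absurd hm h
  · push Not at hz
    rw [Finset.sum_eq_zero fun m hm => if_neg (hz m hm)]
    exact h0

/-- Convolution with a probability measure averages atoms and cannot raise their upper bound. -/
lemma coeff_mul_le {x y : AddMonoidAlgebra ℝ ℝ} {B : ℝ} (hx : ∀ z, x.coeff z ≤ B)
    (hy : NonnegOn Set.univ y) (hmass : mass ℝ y = 1) (z : ℝ) : (x * y).coeff z ≤ B := by
  classical
  rw [mul_comm, coeff_eq_pair, pair_mul]
  calc _ ≤ pair (fun _ => B * 1) y := hy.pair_mono fun b _ => ?_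
    _ = B := by rw [pair_const_mul, ← mass_apply, hmass, mul_one]
  have : pair (fun c => if b + c = z then (1 : ℝ) else 0) x = x.coeff (z - b) := by
    rw [coeff_eq_pair]
    refine pair_congr fun c _ => ?_
    simp only [eq_sub_iff_add_eq']
  rw [this, mul_one]
  exact hx _

/-- In diagonal coordinates the planar simple walk is a pair of independent coin walks. For p ≠ 0 at
least one of the two projected coins is nondegenerate. -/
lemma stepLaw_eq_mul (p : EuclideanSpace ℝ (Fin 2)) :
    stepLaw p = coin ((p 0 + p 1) / 2) * coin ((p 0 - p 1) / 2) := by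
  rw [stepLaw, Fin.sum_univ_two, coin, coin, add_mul, mul_add, mul_add]
  simp only [single_mul_single]
  have h1 : (p 0 + p 1) / 2 + (p 0 - p 1) / 2 = p 0 := by ring
  have h2 : (p 0 + p 1) / 2 + -((p 0 - p 1) / 2) = p 1 := by ring
  have h3 : -((p 0 + p 1) / 2) + (p 0 - p 1) / 2 = -p 1 := by ring
  have h4 : -((p 0 + p 1) / 2) + -((p 0 - p 1) / 2) = -p 0 := by ring
  rw [h1, h2, h3, h4]
  norm_num
  abel

lemma coeff_stepLaw_pow_le {p : EuclideanSpace ℝ (Fin 2)} (hp : p ≠ 0) (n : ℕ) (hn : 0 < n) :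
    (stepLaw p ^ n).coeff 0 ≤ 1 / √n := by
  rw [stepLaw_eq_mul, mul_pow]
  by_cases h : (p 0 + p 1) / 2 = 0
  · have h' : (p 0 - p 1) / 2 ≠ 0 := by
      intro h'
      apply hp
      ext i
      fin_cases i <;> simp <;> linarith
    rw [mul_comm]
    exact coeff_mul_le (coeff_coin_pow_le h' n hn) ((nonnegOn_coin _).pow n) (mass_coin_pow _ n) 0
  · exact coeff_mul_le (coeff_coin_pow_le h n hn) ((nonnegOn_coin _).pow n) (mass_coin_pow _ n) 0

lemma summable_inv_sqrt_div : Summable fun n : ℕ => 1 / √((n + 1 : ℕ) : ℝ) / (n + 1) := by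
  have h := (summable_nat_add_iff 1).2
    (Real.summable_one_div_nat_rpow.2 (by norm_num : (1 : ℝ) < 3 / 2))
  refine h.congr fun n => ?_
  have hn : (0 : ℝ) < (n + 1 : ℕ) := by positivity
  rw [div_div]
  congr 1
  rw [Real.sqrt_eq_rpow, show ((3 : ℝ) / 2) = 1 / 2 + 1 by norm_num, Real.rpow_add hn,
    Real.rpow_one]
  push_cast
  ring

end ReturnBound

/-! ### Comparison of the planar walk with its projection. -/

section LatticeWalk
open AddMonoidAlgebra

/-- The law of a step of the simple random walk on `ℤ²`. -/
def latticeLaw : AddMonoidAlgebra ℝ (Fin 2 → ℤ) :=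
  ∑ i, (single (Pi.single i 1) (1 / 4) + single (-Pi.single i 1) (1 / 4))

lemma nonnegOn_latticeLaw : NonnegOn Set.univ latticeLaw :=
  Finset.sum_induction _ (NonnegOn Set.univ) (fun _ _ => .add) .zero fun _ _ =>
    (nonnegOn_single (Set.mem_univ _) (by norm_num)).add (nonnegOn_single (Set.mem_univ _) (by norm_num))

lemma nonnegOn_latticeLaw_pow (n : ℕ) : NonnegOn Set.univ (latticeLaw ^ n) := by
  induction n with
  | zero => exact NonnegOn.one trivial
  | succ n ih => rw [pow_succ]; exact ih.mul nonnegOn_latticeLaw fun _ _ _ _ => trivial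

/-- The scalar product with `p` as a homomorphism. -/
def slopeHom (p : EuclideanSpace ℝ (Fin 2)) : (Fin 2 → ℤ) →+ ℝ where
  toFun := slopeDot p
  map_zero' := by simp [slopeDot]
  map_add' x y := by simp [slopeDot, mul_add, Finset.sum_add_distrib]

lemma mapDomainAlgHom_slopeHom_single (p : EuclideanSpace ℝ (Fin 2)) (z : Fin 2 → ℤ) (c : ℝ) :
    mapDomainAlgHom ℝ ℝ (slopeHom p) (single z c) = single (slopeDot p z) c := by
  simp [slopeHom]

lemma mapDomain_latticeLaw (p : EuclideanSpace ℝ (Fin 2)) :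
    mapDomainAlgHom ℝ ℝ (slopeHom p) latticeLaw = stepLaw p := by
  have h0 : slopeDot p 0 = 0 := by simp [slopeDot]
  have h1 : ∀ i, slopeDot p (Pi.single i 1) = p i := fun i => by
    have := slopeDot_add_single p 0 i
    rwa [h0, zero_add, zero_add] at this
  have h2 : ∀ i, slopeDot p (-Pi.single i 1) = -p i := fun i => by
    have := slopeDot_sub_single p 0 i
    rwa [h0, zero_sub, zero_sub] at this
  simp only [latticeLaw, stepLaw, map_sum, map_add, mapDomainAlgHom_slopeHom_single, h1, h2]

lemma pair_mapDomain (p : EuclideanSpace ℝ (Fin 2)) (φ : ℝ → ℝ)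
    (x : AddMonoidAlgebra ℝ (Fin 2 → ℤ)) :
    pair φ (mapDomainAlgHom ℝ ℝ (slopeHom p) x) = pair (fun z => φ (slopeDot p z)) x := by
  induction x using single_induction with
  | h0 => simp
  | hadd x y hx hy => rw [map_add, map_add, map_add, hx, hy]
  | hs z c => rw [mapDomainAlgHom_slopeHom_single, pair_single, pair_single]

open Classical in
lemma coeff_stepLaw_pow (p : EuclideanSpace ℝ (Fin 2)) (n : ℕ) : (stepLaw p ^ n).coeff 0 =
    pair (fun z => if slopeDot p z = 0 then 1 else 0) (latticeLaw ^ n) := by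
  rw [← mapDomain_latticeLaw, ← map_pow, coeff_eq_pair, pair_mapDomain]

lemma coeff_latticeLaw_pow_le (p : EuclideanSpace ℝ (Fin 2)) (n : ℕ) :
    (latticeLaw ^ n).coeff 0 ≤ (stepLaw p ^ n).coeff 0 := by
  classical
  rw [coeff_stepLaw_pow, coeff_eq_pair]
  refine (nonnegOn_latticeLaw_pow n).pair_mono fun z _ => ?_
  split_ifs with h1 h2 h2
  · exact le_rfl
  · exact absurd (by simp [h1, slopeDot]) h2
  · norm_num
  · exact le_rfl

/-- A lattice vector orthogonal to p is projected to 0 and adds its own atom; this is the source of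
strict inequality. -/
lemma coeff_latticeLaw_pow_add_le {p : EuclideanSpace ℝ (Fin 2)} {w : Fin 2 → ℤ} (hw : w ≠ 0)
    (hpw : slopeDot p w = 0) (n : ℕ) :
    (latticeLaw ^ n).coeff 0 + (latticeLaw ^ n).coeff w ≤ (stepLaw p ^ n).coeff 0 := by
  classical
  rw [coeff_stepLaw_pow, coeff_eq_pair, coeff_eq_pair, ← pair_add]
  refine (nonnegOn_latticeLaw_pow n).pair_mono fun z _ => ?_
  by_cases h1 : z = 0
  · subst h1; simp [hw.symm, slopeDot]
  · by_cases h2 : z = w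
    · subst h2; simp [h1, hpw]
    · simp only [h1, h2, if_false, add_zero]; split_ifs <;> norm_num

lemma coeff_stepLaw_pow_eq {p : EuclideanSpace ℝ (Fin 2)} {n : ℕ}
    (h : ∀ z, (latticeLaw ^ n).coeff z ≠ 0 → z ≠ 0 → slopeDot p z ≠ 0) :
    (stepLaw p ^ n).coeff 0 = (latticeLaw ^ n).coeff 0 := by
  classical
  rw [coeff_stepLaw_pow, coeff_eq_pair]
  refine pair_congr fun z hz => ?_
  by_cases h1 : z = 0
  · subst h1; simp [slopeDot]
  · rw [if_neg (h z hz h1), if_neg h1]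

/-- Every lattice point is reached by the walk. -/
lemma exists_coeff_latticeLaw_pow_pos (w : Fin 2 → ℤ) : ∃ n, 0 < (latticeLaw ^ n).coeff w := by
  classical
  -- The reachable points are closed under addition by concatenating paths, and they contain all
  -- ±e_i.
  let S : AddSubmonoid (Fin 2 → ℤ) :=
    { carrier := {w | ∃ n, 0 < (latticeLaw ^ n).coeff w}
      zero_mem' := ⟨0, by simp [one_def]⟩
      add_mem' := by
        rintro v w ⟨n, hn⟩ ⟨k, hk⟩
        refine ⟨n + k, ?_⟩
        have h1 : (latticeLaw ^ n).coeff v * (latticeLaw ^ k).coeff w ≤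
            (latticeLaw ^ (n + k)).coeff (v + w) := by
          rw [pow_add, coeff_eq_pair _ (v + w), pair_mul, mul_comm, coeff_eq_pair _ v,
            ← pair_const_mul]
          refine (nonnegOn_latticeLaw_pow n).pair_mono fun z _ => ?_
          by_cases hz : z = v
          · subst hz
            simp only [if_true, mul_one, add_right_inj]
            rw [coeff_eq_pair]
          · simp only [hz, if_false, mul_zero]
            exact (nonnegOn_latticeLaw_pow k).pair_nonneg fun y _ => by split_ifs <;> norm_num
        exact (mul_pos hn hk).trans_le h1 }
  have hgen : ∀ i, (Pi.single i 1 : Fin 2 → ℤ) ∈ S ∧ (-Pi.single i 1 : Fin 2 → ℤ) ∈ S := by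
    have h : ∀ v : Fin 2 → ℤ, ∀ i, (v = Pi.single i 1 ∨ v = -Pi.single i 1) → v ∈ S := by
      intro v i hv
      refine ⟨1, ?_⟩
      rw [pow_one, coeff_eq_pair, latticeLaw, map_sum]
      refine Finset.sum_pos' (fun j _ => ?_) ⟨i, Finset.mem_univ _, ?_⟩
      · rw [map_add, pair_single, pair_single]; positivity
      · rw [map_add, pair_single, pair_single]
        rcases hv with rfl | rfl
        · rw [if_pos rfl]; positivity
        · rw [if_pos (rfl : -Pi.single i 1 = -Pi.single i 1)]; positivity
    exact fun i => ⟨h _ i (Or.inl rfl), h _ i (Or.inr rfl)⟩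
  have hint : ∀ i (k : ℤ), (k • Pi.single i 1 : Fin 2 → ℤ) ∈ S := by
    intro i k
    obtain ⟨n, rfl | rfl⟩ := k.eq_nat_or_neg
    · rw [natCast_zsmul]; exact S.nsmul_mem (hgen i).1 n
    · rw [neg_smul, ← smul_neg, natCast_zsmul]; exact S.nsmul_mem (hgen i).2 n
  have hw : w = w 0 • Pi.single 0 1 + w 1 • Pi.single 1 1 := by
    ext i; fin_cases i <;> simp
  have : w ∈ S := by rw [hw]; exact S.add_mem (hint 0 _) (hint 1 _)
  exact this

end LatticeWalk

/-! ### The Fourier coefficient as a series of return probabilities. -/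

section Fourier
open AddMonoidAlgebra

/-- The negative of the characteristic function of the simple random walk on `ℤ²`. -/
def negChar (θ : Fin 2 → ℝ) : ℝ := -(1 / 2 * ∑ k, Real.cos (θ k))

/-- Evaluation of a Laurent polynomial at the torus point `θ + (π, π)`. -/
def torusEval (θ : Fin 2 → ℝ) : AddMonoidAlgebra ℝ (Fin 2 → ℤ) →ₐ[ℝ] ℂ :=
  AddMonoidAlgebra.lift ℝ ℂ (Fin 2 → ℤ)
    { toFun := fun z => ∏ k, Complex.exp ((z.toAdd k : ℂ) * Complex.I * ((θ k + Real.pi : ℝ) : ℂ))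
      map_one' := by simp
      map_mul' := fun z w => by
        rw [← Finset.prod_mul_distrib]
        refine Finset.prod_congr rfl fun k _ => ?_
        rw [← Complex.exp_add]
        congr 1
        simp only [toAdd_mul, Pi.add_apply]
        push_cast
        ring }

lemma torusEval_single (θ : Fin 2 → ℝ) (z : Fin 2 → ℤ) (c : ℝ) : torusEval θ (single z c) =
    c * ∏ k, Complex.exp ((z k : ℂ) * Complex.I * ((θ k + Real.pi : ℝ) : ℂ)) := by
  simp [torusEval, AddMonoidAlgebra.lift_single]

/-- The shift by (π, π) changes the sign of every cosine. It produces 1 + ½∑cos rather than 1 -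
½∑cos, and does not affect integrals over a period. -/
lemma torusEval_latticeLaw (θ : Fin 2 → ℝ) : torusEval θ latticeLaw = negChar θ := by
  have h : ∀ t : ℝ, Complex.exp (Complex.I * ((t + Real.pi : ℝ) : ℂ)) +
      Complex.exp (-Complex.I * ((t + Real.pi : ℝ) : ℂ)) = -2 * (Real.cos t : ℂ) := by
    intro t
    have h1 : (Real.cos t : ℂ) = -Complex.cos ((t + Real.pi : ℝ) : ℂ) := by
      rw [← Complex.ofReal_cos, Real.cos_add_pi]; push_cast; ring
    rw [h1, Complex.cos]
    ring_nf
  have h0 := h (θ 0)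
  have h1 := h (θ 1)
  simp only [latticeLaw, Fin.sum_univ_two, map_add, torusEval_single, Fin.prod_univ_two, negChar]
  simp at h0 h1 ⊢
  linear_combination h0 / 4 + h1 / 4

lemma continuous_torusEval (x : AddMonoidAlgebra ℝ (Fin 2 → ℤ)) :
    Continuous fun θ => torusEval θ x := by
  induction x using single_induction with
  | h0 => simpa using continuous_const
  | hadd x y hx hy => simp only [map_add]; exact hx.add hy
  | hs z c =>
    simp only [torusEval_single]
    fun_prop

lemma integral_exp_int (n : ℤ) : ∫ t in Set.Icc (-Real.pi) Real.pi,
    Complex.exp ((n : ℂ) * Complex.I * ((t + Real.pi : ℝ) : ℂ)) =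
      if n = 0 then (2 * Real.pi : ℂ) else 0 := by
  rw [integral_Icc_eq_integral_Ioc, ← intervalIntegral.integral_of_le (by linarith [Real.pi_pos])]
  split_ifs with hn
  · subst hn
    simp
    ring
  · have hc : (n : ℂ) * Complex.I ≠ 0 := by simp [hn]
    have h1 : ∀ t : ℝ, Complex.exp ((n : ℂ) * Complex.I * ((t + Real.pi : ℝ) : ℂ)) =
        Complex.exp ((n : ℂ) * Complex.I * Real.pi) * Complex.exp ((n : ℂ) * Complex.I * t) := by
      intro t
      rw [← Complex.exp_add]
      congr 1
      push_cast
      ring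
    simp only [h1]
    rw [intervalIntegral.integral_const_mul, integral_exp_mul_complex hc]
    have h2 : Complex.exp ((n : ℂ) * Complex.I * Real.pi) =
        Complex.exp ((n : ℂ) * Complex.I * ((-Real.pi : ℝ) : ℂ)) := by
      rw [Complex.exp_eq_exp_iff_exists_int]
      exact ⟨n, by push_cast; ring⟩
    rw [h2]
    simp

lemma periodCell_eq_pi (d : ℕ) :
    periodCell d = Set.univ.pi fun _ => Set.Icc (-Real.pi) Real.pi := by
  rw [periodCell, Set.pi_univ_Icc]

lemma isCompact_periodCell (d : ℕ) : IsCompact (periodCell d) := isCompact_Icc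

lemma integral_torusEval (x : AddMonoidAlgebra ℝ (Fin 2 → ℤ)) :
    ∫ θ in periodCell 2, torusEval θ x = ((2 * Real.pi) ^ 2 * x.coeff 0 : ℝ) := by
  classical
  have hint : ∀ x : AddMonoidAlgebra ℝ (Fin 2 → ℤ),
      IntegrableOn (fun θ => torusEval θ x) (periodCell 2) := fun x =>
    (continuous_torusEval x).continuousOn.integrableOn_compact (isCompact_periodCell 2)
  induction x using single_induction with
  | h0 => simp
  | hadd x y hx hy =>
    simp only [map_add]
    rw [integral_add (hint x) (hint y), hx, hy, coeff_add, Finsupp.add_apply]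
    push_cast
    ring
  | hs z c =>
    simp only [torusEval_single]
    rw [integral_const_mul, periodCell_eq_pi, volume_pi, Measure.restrict_pi_pi,
      integral_fintype_prod_eq_prod (f := fun k t =>
        Complex.exp ((z k : ℂ) * Complex.I * ((t + Real.pi : ℝ) : ℂ)))]
    simp only [integral_exp_int, Fin.prod_univ_two, coeff_single, Finsupp.single_apply]
    by_cases hz : z = 0
    · subst hz
      simp
      ring
    · rw [if_neg hz]
      have : ¬ (z 0 = 0 ∧ z 1 = 0) := fun h => hz (by ext i; fin_cases i <;> simp [h])
      rw [not_and_or] at this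
      rcases this with h | h <;> simp [h]

lemma integral_negChar_pow (n : ℕ) :
    ∫ θ in periodCell 2, negChar θ ^ n = (2 * Real.pi) ^ 2 * (latticeLaw ^ n).coeff 0 := by
  have h := integral_torusEval (latticeLaw ^ n)
  simp only [map_pow, torusEval_latticeLaw, ← Complex.ofReal_pow] at h
  rw [integral_complex_ofReal] at h
  exact_mod_cast h

lemma volume_periodCell : volume.real (periodCell 2) = (2 * Real.pi) ^ 2 := by
  have := integral_negChar_pow 0
  simpa [one_def] using this

lemma continuous_negChar : Continuous negChar := by
  unfold negChar; fun_prop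

lemma abs_negChar_le (θ : Fin 2 → ℝ) : |negChar θ| ≤ 1 := by
  rw [negChar, abs_neg, Fin.sum_univ_two, abs_le]
  constructor <;> linarith [Real.neg_one_le_cos (θ 0), Real.neg_one_le_cos (θ 1),
    Real.cos_le_one (θ 0), Real.cos_le_one (θ 1)]

/-- Modulus 1 forces cos θ₀ = ±1, hence θ₀ ∈ πℤ, a null set. Off this set the logarithmic series
converges. -/
lemma ae_abs_negChar_lt : ∀ᵐ θ ∂(volume : Measure (Fin 2 → ℝ)), |negChar θ| < 1 := by
  have h : ∀ᵐ θ ∂(volume : Measure (Fin 2 → ℝ)), ∀ k : ℤ, θ 0 ≠ k * Real.pi := by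
    rw [ae_all_iff]
    intro k
    exact Measure.ae_eval_ne (μ := fun _ : Fin 2 => (volume : Measure ℝ)) 0 _
  filter_upwards [h] with θ hθ
  have hs : Real.sin (θ 0) ≠ 0 := by
    rw [Ne, Real.sin_eq_zero_iff]
    rintro ⟨k, hk⟩
    exact hθ k hk.symm
  have hc : |Real.cos (θ 0)| < 1 := by
    rw [← sq_lt_one_iff_abs_lt_one]
    have := Real.sin_sq_add_cos_sq (θ 0)
    have : 0 < Real.sin (θ 0) ^ 2 := by positivity
    linarith
  rw [abs_lt] at hc
  rw [negChar, abs_neg, Fin.sum_univ_two, abs_lt]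
  constructor <;> linarith [Real.neg_one_le_cos (θ 1), Real.cos_le_one (θ 1)]

lemma coeff_latticeLaw_pow_le_inv_sqrt (n : ℕ) (hn : 0 < n) :
    (latticeLaw ^ n).coeff 0 ≤ 1 / √n := by
  have hp : (EuclideanSpace.single 0 1 : EuclideanSpace ℝ (Fin 2)) ≠ 0 := by simp
  exact (coeff_latticeLaw_pow_le _ n).trans (coeff_stepLaw_pow_le hp n hn)

/-- Even powers integrate to return probabilities; an odd power is dominated by the even power just
below it, which explains n + 1 under the root. -/
lemma integral_abs_negChar_pow_le (n : ℕ) :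
    ∫ θ in periodCell 2, |negChar θ| ^ (n + 2) ≤ (2 * Real.pi) ^ 2 * (1 / √((n + 1 : ℕ) : ℝ)) := by
  have hint : ∀ k : ℕ, IntegrableOn (fun θ => |negChar θ| ^ k) (periodCell 2) := fun k =>
    ((continuous_negChar.abs).pow k).continuousOn.integrableOn_compact (isCompact_periodCell 2)
  have heven : ∀ k : ℕ, Even k → 0 < k →
      ∫ θ in periodCell 2, |negChar θ| ^ k ≤ (2 * Real.pi) ^ 2 * (1 / √(k : ℝ)) := by
    intro k hk hk0
    simp only [hk.pow_abs, integral_negChar_pow]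
    gcongr
    exact coeff_latticeLaw_pow_le_inv_sqrt k hk0
  rcases Nat.even_or_odd n with hn | hn
  · refine (heven (n + 2) (hn.add even_two) (by omega)).trans ?_
    gcongr
    omega
  · refine le_trans ?_ (heven (n + 1) hn.add_one (by omega))
    refine integral_mono (hint _) (hint _) fun θ => ?_
    exact pow_le_pow_of_le_one (abs_nonneg _) (abs_negChar_le θ) (by omega)

/-- By Tonelli, summable L¹ norms suffice, so the logarithmic singularity of the symbol needs no
local analysis. -/
lemma integrable_of_hasSum {α : Type*} [MeasurableSpace α] {μ : Measure α} {F : ℕ → α → ℝ}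
    {f : α → ℝ} (hf : AEStronglyMeasurable f μ) (hF : ∀ n, Integrable (F n) μ)
    (hsum : Summable fun n => ∫ x, ‖F n x‖ ∂μ) (h : ∀ᵐ x ∂μ, HasSum (fun n => F n x) (f x)) :
    Integrable f μ := by
  refine ⟨hf, ?_⟩
  have h1 : ∫⁻ x, ‖f x‖ₑ ∂μ ≤ ∫⁻ x, ∑' n, ‖F n x‖ₑ ∂μ := by
    refine lintegral_mono_ae ?_
    filter_upwards [h] with x hx
    rw [← hx.tsum_eq]
    exact enorm_tsum_le_tsum_enorm
  refine h1.trans_lt ?_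
  rw [lintegral_tsum fun n => (hF n).1.enorm]
  simp only [← ofReal_integral_norm_eq_lintegral_enorm (hF _)]
  exact hsum.tsum_ofReal_lt_top

lemma hasSum_symbolS : ∀ᵐ θ ∂(volume : Measure (Fin 2 → ℝ)),
    HasSum (fun n : ℕ => -(negChar θ ^ (n + 1) / (n + 1))) (symbolS 2 θ) := by
  filter_upwards [ae_abs_negChar_lt] with θ hθ
  have h := (Real.hasSum_pow_div_log_of_abs_lt_one hθ).neg
  have h2 : symbolS 2 θ = - -Real.log (1 - negChar θ) := by
    rw [symbolS, negChar, neg_neg, sub_neg_eq_add]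
    norm_num
  rwa [h2]

lemma integrable_negChar_pow_div (n : ℕ) :
    IntegrableOn (fun θ => -(negChar θ ^ (n + 1) / (n + 1))) (periodCell 2) :=
  Continuous.continuousOn (by have := continuous_negChar; fun_prop)
    |>.integrableOn_compact (isCompact_periodCell 2)

lemma summable_integral_negChar_pow_div :
    Summable fun n : ℕ => ∫ θ in periodCell 2, ‖-(negChar θ ^ (n + 1) / (n + 1))‖ := by
  -- The first power is dropped because the integral bound starts at exponent 2.
  rw [← summable_nat_add_iff 1]
  refine Summable.of_nonneg_of_le (fun n => integral_nonneg fun _ => norm_nonneg _) (fun n => ?_)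
    (summable_inv_sqrt_div.mul_left ((2 * Real.pi) ^ 2))
  have h1 : ∀ θ, ‖-(negChar θ ^ (n + 1 + 1) / ((n + 1 : ℕ) + 1 : ℝ))‖ =
      |negChar θ| ^ (n + 2) * ((n + 1 : ℕ) + 1 : ℝ)⁻¹ := fun θ => by
    rw [norm_neg, norm_div, norm_pow, Real.norm_eq_abs, Real.norm_eq_abs,
      abs_of_pos (by positivity : (0 : ℝ) < (n + 1 : ℕ) + 1), div_eq_mul_inv]
  simp only [h1]
  rw [integral_mul_const, mul_div_assoc']
  rw [← div_eq_mul_inv]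
  have := integral_abs_negChar_pow_le n
  gcongr
  linarith

theorem integrableOn_symbolS : IntegrableOn (symbolS 2) (periodCell 2) := by
  refine integrable_of_hasSum ?_ integrable_negChar_pow_div summable_integral_negChar_pow_div
    (ae_restrict_of_ae hasSum_symbolS)
  exact Measurable.aestronglyMeasurable (by unfold symbolS; fun_prop)

theorem symbolSHat_zero :
    symbolSHat 2 0 = -∑' n : ℕ, (latticeLaw ^ (n + 1)).coeff 0 / (n + 1) := by
  have h1 : ∫ θ in periodCell 2, symbolS 2 θ =
      (2 * Real.pi) ^ 2 * -∑' n : ℕ, (latticeLaw ^ (n + 1)).coeff 0 / (n + 1) := by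
    have h2 := integral_tsum_of_summable_integral_norm integrable_negChar_pow_div
      summable_integral_negChar_pow_div
    have h3 : ∫ θ in periodCell 2, symbolS 2 θ =
        ∫ θ in periodCell 2, ∑' n : ℕ, -(negChar θ ^ (n + 1) / (n + 1)) :=
      integral_congr_ae (ae_restrict_of_ae (hasSum_symbolS.mono fun θ h => h.tsum_eq.symm))
    rw [h3, ← h2, ← tsum_neg, ← tsum_mul_left]
    refine tsum_congr fun n => ?_
    rw [integral_neg, integral_div, integral_negChar_pow]
    ring
  rw [symbolSHat, setAverage_eq, volume_periodCell]
  have h2 : (fun θ : Fin 2 → ℝ => Complex.exp (-Complex.I * ∑ k, (((0 : Fin 2 → ℤ) k : ℤ) : ℂ) *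
      (θ k : ℂ)) * (symbolS 2 θ : ℂ)) = fun θ => (symbolS 2 θ : ℂ) := by
    funext θ; simp
  rw [h2, integral_complex_ofReal, h1, Complex.real_smul, ← Complex.ofReal_mul, Complex.ofReal_re,
    inv_mul_cancel_left₀ (by positivity)]

end Fourier

/-! ### Limits of H and strictness on lattice directions. -/

section Hamiltonian

variable {p : EuclideanSpace ℝ (Fin 2)}

/-- The exponent `∑ P(p · Sₙ = 0) / n` of the Hamiltonian. -/
def returnExponent (p : EuclideanSpace ℝ (Fin 2)) : ℝ :=
  ∑' n : ℕ, (stepLaw p ^ (n + 1)).coeff 0 / (n + 1)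

lemma coeff_stepLaw_pow_nonneg (p : EuclideanSpace ℝ (Fin 2)) (n : ℕ) :
    0 ≤ (stepLaw p ^ n).coeff 0 := ((nonnegOn_stepLaw p).pow n 0).1

lemma coeff_stepLaw_pow_div_le (hp : p ≠ 0) (n : ℕ) :
    (stepLaw p ^ (n + 1)).coeff 0 / (n + 1) ≤ 1 / √((n + 1 : ℕ) : ℝ) / (n + 1) :=
  div_le_div_of_nonneg_right (coeff_stepLaw_pow_le hp (n + 1) n.succ_pos) (by positivity)

lemma summable_stepLaw (hp : p ≠ 0) :
    Summable fun n : ℕ => (stepLaw p ^ (n + 1)).coeff 0 / (n + 1) :=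
  Summable.of_nonneg_of_le
    (fun n => div_nonneg (coeff_stepLaw_pow_nonneg p _) (by positivity))
    (coeff_stepLaw_pow_div_le hp) summable_inv_sqrt_div

lemma summable_latticeLaw : Summable fun n : ℕ => (latticeLaw ^ (n + 1)).coeff 0 / (n + 1) :=
  Summable.of_nonneg_of_le
    (fun n => div_nonneg (nonnegOn_latticeLaw_pow _ 0).1 (by positivity))
    (fun n => div_le_div_of_nonneg_right (coeff_latticeLaw_pow_le_inv_sqrt (n + 1) n.succ_pos)
      (by positivity)) summable_inv_sqrt_div

theorem latticeHamiltonian_sq (hp : p ≠ 0) :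
    latticeHamiltonian p ^ 2 = 4 * Real.exp (-returnExponent p) * ‖p‖ ^ 2 := by
  obtain ⟨u, hu, h⟩ := exists_halfSpaceSolution hp (summable_stepLaw hp)
  rw [latticeHamiltonian_eq hp u hu, h, returnExponent]

lemma slopeDot_two (p : EuclideanSpace ℝ (Fin 2)) (z : Fin 2 → ℤ) :
    slopeDot p z = p 0 * z 0 + p 1 * z 1 := by
  rw [slopeDot, Fin.sum_univ_two]

/-- Rotation by a right angle preserves ℤ² and exchanges parallel with orthogonal vectors; this is
special to the plane. -/
lemma isMultipleOfLatticeVector_iff :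
    IsMultipleOfLatticeVector p ↔ ∃ w : Fin 2 → ℤ, w ≠ 0 ∧ slopeDot p w = 0 := by
  have hrot : ∀ z : Fin 2 → ℤ, z ≠ 0 → (![-z 1, z 0] : Fin 2 → ℤ) ≠ 0 := by
    intro z hz h
    apply hz
    have h0 := congrFun h 0
    have h1 := congrFun h 1
    simp at h0 h1
    ext i; fin_cases i <;> simp [h0, h1]
  constructor
  · rintro ⟨t, z, hz, h⟩
    refine ⟨![-z 1, z 0], hrot z hz, ?_⟩
    rw [slopeDot_two, h 0, h 1]
    simp
    ring
  · rintro ⟨w, hw, h⟩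
    rw [slopeDot_two] at h
    have hpos : (0 : ℝ) < (w 0 : ℝ) ^ 2 + (w 1 : ℝ) ^ 2 := by
      by_contra hcon
      have h0 : (w 0 : ℝ) = 0 := by nlinarith [sq_nonneg (w 0 : ℝ), sq_nonneg (w 1 : ℝ)]
      have h1 : (w 1 : ℝ) = 0 := by nlinarith [sq_nonneg (w 0 : ℝ), sq_nonneg (w 1 : ℝ)]
      apply hw
      ext i
      fin_cases i
      · exact_mod_cast h0
      · exact_mod_cast h1
    refine ⟨(p 1 * w 0 - p 0 * w 1) / ((w 0 : ℝ) ^ 2 + (w 1 : ℝ) ^ 2), ![-w 1, w 0],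
      hrot w hw, fun i => ?_⟩
    rw [div_mul_eq_mul_div, eq_div_iff hpos.ne']
    fin_cases i
    · simp
      linear_combination (w 0 : ℝ) * h
    · simp
      linear_combination (w 1 : ℝ) * h

/-- Both p and q lie on the line orthogonal to z, so their determinant vanishes. -/
lemma exists_eq_smul_of_slopeDot_eq_zero {q : EuclideanSpace ℝ (Fin 2)} (hp : p ≠ 0)
    {z : Fin 2 → ℤ} (hz : z ≠ 0) (hpz : slopeDot p z = 0) (hqz : slopeDot q z = 0) :
    ∃ t : ℝ, q = t • p := by
  rw [slopeDot_two] at hpz hqz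
  have hdet : q 0 * p 1 - q 1 * p 0 = 0 := by
    by_contra hne
    have h0 : (z 0 : ℝ) = 0 := by
      have : (q 0 * p 1 - q 1 * p 0) * (z 0 : ℝ) = 0 := by
        linear_combination p 1 * hqz - q 1 * hpz
      exact (mul_eq_zero.1 this).resolve_left hne
    have h1 : (z 1 : ℝ) = 0 := by
      have : (q 0 * p 1 - q 1 * p 0) * (z 1 : ℝ) = 0 := by
        linear_combination q 0 * hpz - p 0 * hqz
      exact (mul_eq_zero.1 this).resolve_left hne
    apply hz
    ext i
    fin_cases i
    · exact_mod_cast h0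
    · exact_mod_cast h1
  have hpos := sum_sq_pos hp
  refine ⟨(q 0 * p 0 + q 1 * p 1) / (p 0 ^ 2 + p 1 ^ 2), ?_⟩
  ext i
  rw [PiLp.smul_apply, smul_eq_mul, div_mul_eq_mul_div, eq_div_iff hpos.ne']
  fin_cases i
  · simp
    linear_combination p 1 * hdet
  · simp
    linear_combination -p 0 * hdet

lemma continuous_slopeDot (z : Fin 2 → ℤ) :
    Continuous fun q : EuclideanSpace ℝ (Fin 2) => slopeDot q z := by
  unfold slopeDot; fun_prop

/-- Continuity of the Hamiltonian along filters that avoid every lattice direction. -/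
theorem tendsto_latticeHamiltonian_sq (hp : p ≠ 0) {l : Filter (EuclideanSpace ℝ (Fin 2))}
    (hl : l ≤ 𝓝 p) (h : ∀ z : Fin 2 → ℤ, z ≠ 0 → ∀ᶠ q in l, slopeDot q z ≠ 0) :
    Tendsto (fun q => latticeHamiltonian q ^ 2) l
      (𝓝 (4 * Real.exp (symbolSHat 2 0) * ‖p‖ ^ 2)) := by
  have hne : ∀ᶠ q in l, q ≠ 0 := hl (isOpen_ne.mem_nhds hp)
  have hexp : Tendsto returnExponent l
      (𝓝 (∑' n : ℕ, (latticeLaw ^ (n + 1)).coeff 0 / (n + 1))) := by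
    refine tendsto_tsum_of_dominated_convergence summable_inv_sqrt_div (fun n => ?_) ?_
    · refine tendsto_const_nhds.congr' ?_
      -- At a fixed time only finitely many lattice points carry mass, so all of them can be avoided
      -- at once and the term becomes constant along `l`.
      have hfin : ∀ᶠ q in l, ∀ z ∈ (latticeLaw ^ (n + 1)).coeff.support,
          z ≠ 0 → slopeDot q z ≠ 0 := by
        rw [Finset.eventually_all]
        intro z _
        by_cases hz : z = 0
        · exact Eventually.of_forall fun q h0 => absurd hz h0
        · exact (h z hz).mono fun q hq _ => hq
      filter_upwards [hfin] with q hq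
      rw [coeff_stepLaw_pow_eq fun z hz => hq z (Finsupp.mem_support_iff.2 hz)]
    · filter_upwards [hne] with q hq n
      rw [Real.norm_of_nonneg (div_nonneg (coeff_stepLaw_pow_nonneg q _) (by positivity))]
      exact coeff_stepLaw_pow_div_le hq n
  rw [symbolSHat_zero]
  have hnorm : Tendsto (fun q : EuclideanSpace ℝ (Fin 2) => ‖q‖ ^ 2) l (𝓝 (‖p‖ ^ 2)) :=
    (Continuous.tendsto (by fun_prop) p).mono_left hl
  refine ((hexp.neg.rexp.const_mul 4).mul hnorm).congr' ?_
  filter_upwards [hne] with q hq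
  rw [latticeHamiltonian_sq hq]

theorem latticeHamiltonian_sq_lt_iff (hp : p ≠ 0) :
    latticeHamiltonian p ^ 2 < 4 * Real.exp (symbolSHat 2 0) * ‖p‖ ^ 2 ↔
      IsMultipleOfLatticeVector p := by
  have hpos : 0 < ‖p‖ := norm_pos_iff.2 hp
  rw [latticeHamiltonian_sq hp, symbolSHat_zero,
    mul_lt_mul_iff_left₀ (by positivity : 0 < ‖p‖ ^ 2),
    mul_lt_mul_iff_right₀ (by norm_num : (0 : ℝ) < 4), Real.exp_lt_exp, neg_lt_neg_iff,
    isMultipleOfLatticeVector_iff]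
  have hle : ∀ n : ℕ, (latticeLaw ^ (n + 1)).coeff 0 / (n + 1) ≤
      (stepLaw p ^ (n + 1)).coeff 0 / (n + 1) := fun n =>
    div_le_div_of_nonneg_right (coeff_latticeLaw_pow_le p _) (by positivity)
  constructor
  · intro hlt
    by_contra! hcon
    refine hlt.ne (tsum_congr fun n => ?_)
    rw [coeff_stepLaw_pow_eq fun z _ hz => hcon z hz]
  · rintro ⟨w, hw, hpw⟩
    obtain ⟨n, hn⟩ := exists_coeff_latticeLaw_pow_pos w
    cases n with
    -- At time 0 the walk sits at 0 ≠ w, so w is reached at a positive time, which the series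
    -- includes.
    | zero => simp [AddMonoidAlgebra.one_def, hw.symm] at hn
    | succ n =>
      refine Summable.tsum_lt_tsum (i := n) hle ?_ summable_latticeLaw (summable_stepLaw hp)
      refine div_lt_div_of_pos_right ?_ (by positivity)
      linarith [coeff_latticeLaw_pow_add_le hw hpw (n + 1)]

end Hamiltonian

end

theorem theoremt :
    -- the objects in the claim are well defined
    IntegrableOn (symbolS 2) (periodCell 2) ∧
    (∀ p : EuclideanSpace ℝ (Fin 2), p ≠ 0 →
      ∃! u : (Fin 2 → ℤ) → ℝ, IsHalfSpaceSolution p u) ∧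
    -- the claim
    ∀ p : EuclideanSpace ℝ (Fin 2), p ≠ 0 →
      Tendsto (fun q => latticeHamiltonian q ^ 2)
        (𝓝[{q | ¬ ∃ t : ℝ, q = t • p}] p)
        (𝓝 (4 * Real.exp (symbolSHat 2 0) * ‖p‖ ^ 2)) ∧
      (¬ IsMultipleOfLatticeVector p →
        Tendsto (fun q => latticeHamiltonian q ^ 2) (𝓝[≠] p)
          (𝓝 (4 * Real.exp (symbolSHat 2 0) * ‖p‖ ^ 2))) ∧
      (latticeHamiltonian p ^ 2 < 4 * Real.exp (symbolSHat 2 0) * ‖p‖ ^ 2 ↔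
        IsMultipleOfLatticeVector p) := by
  refine ⟨integrableOn_symbolS, fun p hp => ?_, fun p hp => ⟨?_, fun hirr => ?_, ?_⟩⟩
  · obtain ⟨u, hu, -⟩ := exists_halfSpaceSolution hp (summable_stepLaw hp)
    exact ⟨u, hu, fun v hv => hv.unique hp hu⟩
  · refine tendsto_latticeHamiltonian_sq hp nhdsWithin_le_nhds fun z hz => ?_
    -- If p·z = 0, then q·z = 0 would put q on ℝp; if p·z ≠ 0, continuity keeps q·z away from 0.
    by_cases hpz : slopeDot p z = 0
    · filter_upwards [self_mem_nhdsWithin] with q hq hqz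
      exact hq (exists_eq_smul_of_slopeDot_eq_zero hp hz hpz hqz)
    · exact nhdsWithin_le_nhds ((continuous_slopeDot z).continuousAt.eventually_ne hpz)
  · refine tendsto_latticeHamiltonian_sq hp nhdsWithin_le_nhds fun z hz => ?_
    have hpz : slopeDot p z ≠ 0 := fun h => hirr (isMultipleOfLatticeVector_iff.2 ⟨z, hz, h⟩)
    exact nhdsWithin_le_nhds ((continuous_slopeDot z).continuousAt.eventually_ne hpz)
  · exact latticeHamiltonian_sq_lt_iff hp
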